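/- A homogeneous linear strain-gradient elastic material in $\mathbb{R}^3$ is given by constant tensors $\mathsf{C}$, $\mathsf{M}$, $\mathsf{A}$ of orders four, five and six with the index symmetries $\mathsf{C}_{ijlm}=\mathsf{C}_{jilm}=\mathsf{C}_{lmij}$, $\mathsf{M}_{ijklm}=\mathsf{M}_{jiklm}=\mathsf{M}_{ijlkm}$, $\mathsf{A}_{ijklmn}=\mathsf{A}_{jiklmn}=\mathsf{A}_{lmnijk}$. For a displacement $u$, with strain $e_{lm}=\frac12(u_{l,m}+u_{m,l})$, put $$\sigma_{ik}=\mathsf{C}_{iklm}e_{lm}+\mathsf{M}_{iklmn}e_{lm,n},\qquad \tau_{ijk}=\mathsf{M}_{lmijk}e_{lm}+\mathsf{A}_{ijklmn}e_{lm,n};$$ equilibrium without body forces is $\sigma_{ik,i}-\tau_{ijk,ij}=0$. The symmetry group of the material is $G_{\mathsf A}\cap G_{\mathsf M}\cap G_{\mathsf C}$, the set of all $Q\in O(3)$ that leave the three tensors invariant. Let $\mathbb{O}\oplus\mathbb{Z}_2^c$ be the group generated by $-1$ and the rotations that preserve the cube aligned with the coordinate axes. A displacement is universal for a class of materials if it satisfies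 the equilibrium equations for every material of that class. Let $\Omega\subseteq\mathbb{R}^3$ be open and connected and let $u$ be a displacement field of class $C^4$ on $\Omega$. The following are equivalent. 1. $u$ is universal on $\Omega$ for the class of materials whose symmetry group is exactly $\mathbb{O}\oplus\mathbb{Z}_2^c$. 2. $u$ is universal on $\Omega$ for the class of all materials whose symmetry group contains $\mathbb{O}\oplus\mathbb{Z}_2^c$. 3. There are constants $a,a_1,b_1,c_1,d_1,d_2,d_3$ and harmonic functions $g_1,g_2,g_3$ of class $C^4$ on $\mathbb{R}^2$ such that on $\Omega$ $$\begin{aligned}u_1&=\tfrac a2x_1(x_3^2-x_2^2)+c_1x_1x_3+b_1x_1x_2+d_1x_1+g_1(x_2,x_3),\\ u_2&=\tfrac a2x_2(x_1^2-x_3^2)+a_1x_1x_2-c_1x_2x_3+d_2x_2+g_2(x_1,x_3),\\ u_3&=\tfrac a2x_3(x_2^2-x_1^2)-a_1x_1x_3-b_1x_2x_3+d_3x_3+g_3(x_1,x_2),\end{aligned}$$ and each $g=g_i(x_p,x_q)$, where $(p,q)=(2,3),(1,3),(1,2)$ for $i=1,2,3$, satisfies $\dfrac{\partial^4g}{\partial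 x_p^2\partial x_q^2}=0$ and $\dfrac{\partial^4g}{\partial x_p^4}+\dfrac{\partial^4g}{\partial x_q^4}=0$. 4. $u$ has the same form on $\Omega$ with some constants and harmonic functions $g_i$ of class $C^4$ on $\mathbb{R}^2$, and there are $C^4$ functions $f_1,\dots,f_{12}:\mathbb{R}\to\mathbb{R}$ with $$\begin{aligned}g_1(x_2,x_3)&=f_1(x_2)+x_3f_2(x_2)+f_3(x_3)+x_2f_4(x_3), & f_1''''(x_2)+x_3f_2''''(x_2)+f_3''''(x_3)+x_2f_4''''(x_3)&=0,\\ g_2(x_1,x_3)&=f_5(x_1)+x_3f_6(x_1)+f_7(x_3)+x_1f_8(x_3), & f_5''''(x_1)+x_3f_6''''(x_1)+f_7''''(x_3)+x_1f_8''''(x_3)&=0,\\ g_3(x_1,x_2)&=f_9(x_1)+x_2f_{10}(x_1)+f_{11}(x_2)+x_1f_{12}(x_2), & f_9''''(x_1)+x_2f_{10}''''(x_1)+f_{11}''''(x_2)+x_1f_{12}''''(x_2)&=0\end{aligned}$$ identically. -/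

import Mathlib

namespace StrainGradient

/-- The partial derivative `∂f/∂xᵢ` of a scalar field in Cartesian coordinates. -/
noncomputable def partialDeriv (i : Fin 3) (f : (Fin 3 → ℝ) → ℝ) : (Fin 3 → ℝ) → ℝ :=
  fun x => fderiv ℝ f x (Pi.single i 1)

/-- The linear strain `e_{lm} = (u_{l,m} + u_{m,l}) / 2`. -/
noncomputable def strain (u : (Fin 3 → ℝ) → Fin 3 → ℝ) (l m : Fin 3) : (Fin 3 → ℝ) → ℝ :=
  fun x => (1 / 2) *
    (partialDeriv m (fun y => u y l) x + partialDeriv l (fun y => u y m) x)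

/-- A homogeneous linear strain-gradient elastic material: the (constant) elasticity tensors of
order four, five and six, with their index symmetries. -/
structure Material where
  C : Fin 3 → Fin 3 → Fin 3 → Fin 3 → ℝ
  M : Fin 3 → Fin 3 → Fin 3 → Fin 3 → Fin 3 → ℝ
  A : Fin 3 → Fin 3 → Fin 3 → Fin 3 → Fin 3 → Fin 3 → ℝ
  C_minor : ∀ i j l m, C i j l m = C j i l m
  C_major : ∀ i j l m, C i j l m = C l m i j
  M_left : ∀ i j k l m, M i j k l m = M j i k l m
  M_right : ∀ i j k l m, M i j k l m = M i j l k m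
  A_minor : ∀ i j k l m n, A i j k l m n = A j i k l m n
  A_major : ∀ i j k l m n, A i j k l m n = A l m n i j k

namespace Material

/-- The Cauchy stress `σ_{ik} = C_{iklm} e_{lm} + M_{iklmn} e_{lm,n}`. -/
noncomputable def cauchyStress (𝓜 : Material) (u : (Fin 3 → ℝ) → Fin 3 → ℝ) (i k : Fin 3) :
    (Fin 3 → ℝ) → ℝ :=
  fun x => (∑ l, ∑ m, 𝓜.C i k l m * strain u l m x) +
    ∑ l, ∑ m, ∑ n, 𝓜.M i k l m n * partialDeriv n (strain u l m) x

/-- The hyper-stress `τ_{ijk} = M_{lmijk} e_{lm} + A_{ijklmn} e_{lm,n}`. -/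
noncomputable def hyperStress (𝓜 : Material) (u : (Fin 3 → ℝ) → Fin 3 → ℝ) (i j k : Fin 3) :
    (Fin 3 → ℝ) → ℝ :=
  fun x => (∑ l, ∑ m, 𝓜.M l m i j k * strain u l m x) +
    ∑ l, ∑ m, ∑ n, 𝓜.A i j k l m n * partialDeriv n (strain u l m) x

/-- Balance of linear momentum on `Ω` without inertia and body forces:
`σ_{ik,i} - τ_{ijk,ij} = 0`. -/
def InEquilibrium (𝓜 : Material) (Ω : Set (Fin 3 → ℝ)) (u : (Fin 3 → ℝ) → Fin 3 → ℝ) : Prop :=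
  ∀ x ∈ Ω, ∀ k : Fin 3,
    (∑ i, partialDeriv i (𝓜.cauchyStress u i k) x) -
      ∑ i, ∑ j, partialDeriv j (partialDeriv i (𝓜.hyperStress u i j k)) x = 0

/-- The symmetry group of the fourth-order tensor. -/
def symmC (𝓜 : Material) : Set (Matrix.orthogonalGroup (Fin 3) ℝ) :=
  {Q | ∀ i j k l, ∑ o, ∑ p, ∑ q, ∑ r,
    Q.1 i o * Q.1 j p * Q.1 k q * Q.1 l r * 𝓜.C o p q r = 𝓜.C i j k l}

/-- The symmetry group of the fifth-order tensor. -/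
def symmM (𝓜 : Material) : Set (Matrix.orthogonalGroup (Fin 3) ℝ) :=
  {Q | ∀ i j k l m, ∑ o, ∑ p, ∑ q, ∑ r, ∑ s,
    Q.1 i o * Q.1 j p * Q.1 k q * Q.1 l r * Q.1 m s * 𝓜.M o p q r s = 𝓜.M i j k l m}

/-- The symmetry group of the sixth-order tensor. -/
def symmA (𝓜 : Material) : Set (Matrix.orthogonalGroup (Fin 3) ℝ) :=
  {Q | ∀ i j k l m n, ∑ o, ∑ p, ∑ q, ∑ r, ∑ s, ∑ t,
    Q.1 i o * Q.1 j p * Q.1 k q * Q.1 l r * Q.1 m s * Q.1 n t * 𝓜.A o p q r s t =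
      𝓜.A i j k l m n}

/-- The symmetry group of the material, `G_A ∩ G_M ∩ G_C`. -/
def symmetryGroup (𝓜 : Material) : Set (Matrix.orthogonalGroup (Fin 3) ℝ) :=
  𝓜.symmA ∩ 𝓜.symmM ∩ 𝓜.symmC

end Material

/-- The vertices `±e₁, ±e₂, ±e₃` of the regular octahedron aligned with the coordinate axes. -/
def octahedronVertices : Set (Fin 3 → ℝ) :=
  {v | ∃ i : Fin 3, v = Pi.single i 1 ∨ v = -Pi.single i 1}

/-- The octahedral group `𝕆`: the rotations that preserve the octahedron (equivalently, the dual
cube) aligned with the coordinate axes. -/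
def octahedralRotations : Set (Matrix.orthogonalGroup (Fin 3) ℝ) :=
  {Q | Q.1.det = 1 ∧ (fun v => Q.1.mulVec v) '' octahedronVertices = octahedronVertices}

/-- The centrosymmetric cubic group `𝕆 ⊕ ℤ₂ᶜ`, generated by `𝕆` and the inversion `-1`. -/
def fullOctahedralGroup : Set (Matrix.orthogonalGroup (Fin 3) ℝ) :=
  {Q | Q ∈ octahedralRotations ∨ -Q ∈ octahedralRotations}

/-- `u` is universal on `Ω` for a class of materials when it satisfies the equilibrium equations
without body forces for every material of the class. -/
def IsUniversal (𝒦 : Set Material) (Ω : Set (Fin 3 → ℝ))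
    (u : (Fin 3 → ℝ) → Fin 3 → ℝ) : Prop :=
  ∀ 𝓜 ∈ 𝒦, 𝓜.InEquilibrium Ω u

/-- `g` is a harmonic function (of class `C⁴`) on the plane. -/
def IsHarmonic (g : ℝ → ℝ → ℝ) : Prop :=
  ContDiff ℝ 4 (Function.uncurry g) ∧
    ∀ x y, iteratedDeriv 2 (fun s => g s y) x + iteratedDeriv 2 (fun t => g x t) y = 0

/-- The fourth-order equations `∂⁴g/∂x²∂y² = 0` and `∂⁴g/∂x⁴ + ∂⁴g/∂y⁴ = 0`. -/
def FourthOrderPDEs (g : ℝ → ℝ → ℝ) : Prop :=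
  (∀ x y, iteratedDeriv 2 (fun s => iteratedDeriv 2 (fun t => g s t) y) x = 0) ∧
    ∀ x y, iteratedDeriv 4 (fun s => g s y) x + iteratedDeriv 4 (fun t => g x t) y = 0

/-- `g(x, y) = f(x) + y k(x) + h(y) + x l(y)` for four functions of one variable
whose fourth derivatives satisfy the compatibility relation. -/
def FourthOrderRepresentation (g : ℝ → ℝ → ℝ) : Prop :=
  ∃ f k h l : ℝ → ℝ,
    ContDiff ℝ 4 f ∧ ContDiff ℝ 4 k ∧ ContDiff ℝ 4 h ∧ ContDiff ℝ 4 l ∧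
    (∀ x y, g x y = f x + y * k x + h y + x * l y) ∧
    ∀ x y, iteratedDeriv 4 f x + y * iteratedDeriv 4 k x + iteratedDeriv 4 h y +
      x * iteratedDeriv 4 l y = 0

/-- `u` has on `Ω` the classical cubic form with the parameters `a, a₁, b₁, c₁, d₁, d₂, d₃` and the
functions `g₁(x₂, x₃)`, `g₂(x₁, x₃)`, `g₃(x₁, x₂)`. The coordinates `x₁, x₂, x₃` are
`x 0, x 1, x 2`. -/
def HasCubicForm (Ω : Set (Fin 3 → ℝ)) (u : (Fin 3 → ℝ) → Fin 3 → ℝ)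
    (a a₁ b₁ c₁ d₁ d₂ d₃ : ℝ) (g₁ g₂ g₃ : ℝ → ℝ → ℝ) : Prop :=
  ∀ x ∈ Ω,
    u x 0 = a / 2 * x 0 * (x 2 ^ 2 - x 1 ^ 2) + c₁ * x 0 * x 2 + b₁ * x 0 * x 1 + d₁ * x 0 +
      g₁ (x 1) (x 2) ∧
    u x 1 = a / 2 * x 1 * (x 0 ^ 2 - x 2 ^ 2) + a₁ * x 0 * x 1 - c₁ * x 1 * x 2 + d₂ * x 1 +
      g₂ (x 0) (x 2) ∧
    u x 2 = a / 2 * x 2 * (x 1 ^ 2 - x 0 ^ 2) - a₁ * x 0 * x 2 - b₁ * x 1 * x 2 + d₃ * x 2 +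
      g₃ (x 0) (x 1)

end StrainGradient

/-! Universality amounts to the system `CubicUniversalityPDEs`: without summation over k, ∂ₖ²uₖ = 0,
Δuₖ = 0, ∂ₖ div u = 0 and Σᵢ ∂ᵢ⁴uₖ = 0.

Necessity. For s ≠ 0 the materials `cubicMaterial s lam μ t` have exactly the cubic symmetry group
(`symmetryGroup_cubicMaterial`), and their equilibrium equation is linear in the four parameters.
The three moduli of C yield the second-order equations; given those, the t-part collapses to Σᵢ
∂ᵢ⁴uₖ.

Sufficiency (`CubicUniversalityPDEs.isUniversal`). Inversion annihilates M, and the C-part is a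
combination of the second-order equations. By reflections, an entry of A can be nonzero only if each
axis occurs an even number of times among its indices. The fourth derivative of u_l that it
multiplies then either contains the index l, and vanishes because the third derivatives of the
normal strain u_{l,l} do, or has its indices in pairs; in that case harmonicity and the quartic
equation give three linear relations between u_{l,pppp}, u_{l,ppqq} and u_{l,qqqq} whose only
solution is zero.

Integration (`exists_cubicForm`). The equation ∂_p∂_q div u = 0 reduces to u_{k,kpq} = 0, so u_{k,k}
is independent of x_k, harmonic in the other two variables and free of mixed derivatives, hence
quadratic. Constancy of div u couples the three quadratics. What remains of u_k is independent of
x_k, harmonic, and satisfies the quartic equation, hence is a polynomial of degree at most four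
(`exists_eq_harmonicQuartic`). On a general connected Ω, ∂ₖg = 0 alone does not make g a function of
(x_p, x_q); comparing derivatives with those of explicit polynomials avoids this and produces gᵢ on
the whole plane. The same polynomial supplies the functions fᵢ of item 4; the converse is
differentiation. -/

namespace StrainGradient

open Filter Topology

local notation "𝐃" => partialDeriv

/-- `f` is of class `Cⁿ` on `Ω`, for a natural number `n`. -/
abbrev CkOn (n : ℕ) (Ω : Set (Fin 3 → ℝ)) (f : (Fin 3 → ℝ) → ℝ) : Prop :=
  ContDiffOn ℝ (n : WithTop ℕ∞) f Ω

/-! ### Calculus of Cartesian partial derivatives -/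

section Calculus

variable {Ω : Set (Fin 3 → ℝ)} {f g : (Fin 3 → ℝ) → ℝ} {x : Fin 3 → ℝ} {n : ℕ}

theorem CkOn.partialDeriv (hf : CkOn (n + 1) Ω f) (hΩ : IsOpen Ω) (i : Fin 3) :
    CkOn n Ω (𝐃 i f) := by
  have h : ContDiffOn ℝ (n : WithTop ℕ∞) (fderiv ℝ f) Ω :=
    hf.fderiv_of_isOpen hΩ (by norm_cast)
  exact h.clm_apply contDiffOn_const

theorem CkOn.differentiableAt (hf : CkOn (n + 1) Ω f) (hΩ : IsOpen Ω) (hx : x ∈ Ω) :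
    DifferentiableAt ℝ f x :=
  (hf.contDiffAt (hΩ.mem_nhds hx)).differentiableAt (by exact_mod_cast Nat.succ_ne_zero n)

theorem partialDeriv_congr (hΩ : IsOpen Ω) (h : ∀ x ∈ Ω, f x = g x) (i : Fin 3) :
    ∀ x ∈ Ω, 𝐃 i f x = 𝐃 i g x := by
  intro x hx
  have : f =ᶠ[𝓝 x] g := by filter_upwards [hΩ.mem_nhds hx] with y hy using h y hy
  simp only [partialDeriv, this.fderiv_eq]

theorem partialDeriv_const (i : Fin 3) (c : ℝ) : 𝐃 i (fun _ => c) = fun _ => 0 := by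
  funext x; simp [partialDeriv]

theorem partialDeriv_eq_zero (hΩ : IsOpen Ω) (h : ∀ x ∈ Ω, f x = 0) (i : Fin 3) :
    ∀ x ∈ Ω, 𝐃 i f x = 0 := by
  intro x hx
  rw [partialDeriv_congr hΩ h i x hx, partialDeriv_const]

theorem partialDeriv_add_apply (hf : DifferentiableAt ℝ f x) (hg : DifferentiableAt ℝ g x)
    (i : Fin 3) : 𝐃 i (fun y => f y + g y) x = 𝐃 i f x + 𝐃 i g x := by
  simp only [partialDeriv]
  rw [fderiv_fun_add hf hg]; rfl

theorem partialDeriv_const_mul_apply (hf : DifferentiableAt ℝ f x) (c : ℝ) (i : Fin 3) :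
    𝐃 i (fun y => c * f y) x = c * 𝐃 i f x := by
  simp only [partialDeriv]
  rw [fderiv_const_mul hf]; rfl

theorem partialDeriv_mul_apply (hf : DifferentiableAt ℝ f x) (hg : DifferentiableAt ℝ g x)
    (i : Fin 3) : 𝐃 i (fun y => f y * g y) x = 𝐃 i f x * g x + f x * 𝐃 i g x := by
  simp only [partialDeriv]
  rw [fderiv_fun_mul hf hg]
  simp; ring

theorem partialDeriv_sum_apply {ι : Type*} {s : Finset ι} {F : ι → (Fin 3 → ℝ) → ℝ}
    (hF : ∀ a ∈ s, DifferentiableAt ℝ (F a) x) (i : Fin 3) :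
    𝐃 i (fun y => ∑ a ∈ s, F a y) x = ∑ a ∈ s, 𝐃 i (F a) x := by
  simp only [partialDeriv]
  rw [fderiv_fun_sum hF]
  simp

theorem partialDeriv_add (hf : Differentiable ℝ f) (hg : Differentiable ℝ g) (i : Fin 3) :
    𝐃 i (fun y => f y + g y) = fun x => 𝐃 i f x + 𝐃 i g x :=
  funext fun x => partialDeriv_add_apply (hf x) (hg x) i

theorem partialDeriv_mul (hf : Differentiable ℝ f) (hg : Differentiable ℝ g) (i : Fin 3) :
    𝐃 i (fun y => f y * g y) = fun x => 𝐃 i f x * g x + f x * 𝐃 i g x :=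
  funext fun x => partialDeriv_mul_apply (hf x) (hg x) i

theorem partialDeriv_sub (hf : Differentiable ℝ f) (hg : Differentiable ℝ g) (i : Fin 3) :
    𝐃 i (fun y => f y - g y) = fun x => 𝐃 i f x - 𝐃 i g x := by
  funext x
  simp only [partialDeriv]
  rw [fderiv_fun_sub (hf x) (hg x)]; rfl

theorem partialDeriv_neg (i : Fin 3) :
    𝐃 i (fun y => -f y) = fun x => -𝐃 i f x := by
  funext x
  simp only [partialDeriv]
  rw [fderiv_fun_neg]; rfl

theorem partialDeriv_pow (hf : Differentiable ℝ f) (m : ℕ) (i : Fin 3) :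
    𝐃 i (fun y => f y ^ (m + 1)) = fun x => (m + 1) * f x ^ m * 𝐃 i f x := by
  induction m with
  | zero => simp
  | succ m ih =>
    have : (fun y => f y ^ (m + 1 + 1)) = fun y => f y ^ (m + 1) * f y := by
      funext y; ring
    rw [this, partialDeriv_mul (f := fun y => f y ^ (m + 1)) (hf.pow _) hf, ih]
    funext y; push_cast; ring

theorem partialDeriv_sq (hf : Differentiable ℝ f) (i : Fin 3) :
    𝐃 i (fun y => f y ^ 2) = fun x => 2 * f x * 𝐃 i f x := by
  rw [partialDeriv_pow hf 1]; funext x; norm_num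

theorem partialDeriv_cube (hf : Differentiable ℝ f) (i : Fin 3) :
    𝐃 i (fun y => f y ^ 3) = fun x => 3 * f x ^ 2 * 𝐃 i f x := by
  rw [partialDeriv_pow hf 2]; funext x; norm_num

theorem partialDeriv_coord (i j : Fin 3) :
    𝐃 i (fun y : Fin 3 → ℝ => y j) = fun _ => if j = i then 1 else 0 := by
  funext x
  have : (fun y : Fin 3 → ℝ => y j) = ContinuousLinearMap.proj (R := ℝ) j := rfl
  simp only [partialDeriv]
  rw [this, ContinuousLinearMap.fderiv]
  simp [Pi.single_apply]

theorem partialDeriv_comm (hΩ : IsOpen Ω) (hf : CkOn (n + 2) Ω f) (i j : Fin 3) :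
    ∀ x ∈ Ω, 𝐃 i (𝐃 j f) x = 𝐃 j (𝐃 i f) x := by
  intro x hx
  have hat := hf.contDiffAt (hΩ.mem_nhds hx)
  have hsymm : IsSymmSndFDerivAt ℝ f x :=
    hat.isSymmSndFDerivAt (by simp only [minSmoothness_of_isRCLikeNormedField]; norm_cast; omega)
  have hd : DifferentiableAt ℝ (fderiv ℝ f) x :=
    (hat.fderiv_right (m := 1) (by norm_cast; omega)).differentiableAt one_ne_zero
  have key : ∀ a b : Fin 3, 𝐃 a (𝐃 b f) x =
      fderiv ℝ (fderiv ℝ f) x (Pi.single a 1) (Pi.single b 1) := by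
    intro a b
    have : fderiv ℝ (fun y => fderiv ℝ f y (Pi.single b 1)) x =
        (fderiv ℝ (fderiv ℝ f) x).flip (Pi.single b 1) := by
      rw [fderiv_clm_apply hd (differentiableAt_const _)]
      simp
    change fderiv ℝ (fun y => fderiv ℝ f y (Pi.single b 1)) x (Pi.single a 1) = _
    rw [this]; rfl
  rw [key, key]
  exact hsymm _ _

theorem fderiv_apply_eq_sum (f : (Fin 3 → ℝ) → ℝ) (x v : Fin 3 → ℝ) :
    fderiv ℝ f x v = ∑ i, v i * 𝐃 i f x := by
  conv_lhs => rw [pi_eq_sum_univ' v]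
  simp only [map_sum, map_smul, smul_eq_mul, partialDeriv]

theorem exists_eq_add_const (hΩ : IsOpen Ω) (hc : IsPreconnected Ω)
    (hf : DifferentiableOn ℝ f Ω) (hg : Differentiable ℝ g)
    (h : ∀ i, ∀ x ∈ Ω, 𝐃 i f x = 𝐃 i g x) : ∃ c, ∀ x ∈ Ω, f x = g x + c := by
  obtain ⟨c, hc⟩ := hΩ.exists_is_const_of_fderiv_eq_zero (f := fun x => f x - g x) hc
    (hf.sub hg.differentiableOn) (by
      intro x hx
      ext1 v
      rw [fderiv_fun_sub (hf.differentiableAt (hΩ.mem_nhds hx)) (hg x)]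
      simp [fderiv_apply_eq_sum, h _ x hx])
  exact ⟨c, fun x hx => by have := hc x hx; linarith⟩

theorem partialDeriv_eq_deriv_update (hf : Differentiable ℝ f) (i : Fin 3) (x : Fin 3 → ℝ)
    (s : ℝ) :
    deriv (fun t => f (Function.update x i t)) s = 𝐃 i f (Function.update x i s) := by
  have h1 := hasDerivAt_update x i s
  exact ((hf _).hasFDerivAt.comp_hasDerivAt s h1).deriv

/-- Bridge between partial derivatives on ℝ³ and the one-variable iterated derivatives in which the
conditions on the gᵢ are phrased. -/
theorem iterate_partialDeriv_eq_iteratedDeriv (i : Fin 3) :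
    ∀ (n : ℕ) (f : (Fin 3 → ℝ) → ℝ), ContDiff ℝ n f → ∀ x,
      (𝐃 i)^[n] f x = iteratedDeriv n (fun t => f (Function.update x i t)) (x i) := by
  intro n
  induction n with
  | zero => intro f _ x; simp
  | succ n ih =>
    intro f hf x
    have hd : Differentiable ℝ f := hf.differentiable (by exact_mod_cast Nat.succ_ne_zero n)
    have h1 : ContDiff ℝ n (𝐃 i f) := by
      have := CkOn.partialDeriv (n := n) (Ω := Set.univ) hf.contDiffOn isOpen_univ i
      exact contDiffOn_univ.1 this
    rw [Function.iterate_succ_apply, ih _ h1, iteratedDeriv_succ']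
    congr 1
    funext s
    exact (partialDeriv_eq_deriv_update hd i x s).symm

end Calculus

/-! ### Functions depending locally on one coordinate -/

section LocalConstancy

variable {Ω B : Set (Fin 3 → ℝ)} {f a b : (Fin 3 → ℝ) → ℝ} {k p q : Fin 3}

/-- Along the segment from `x` to `y` the derivative involves only the directions other than `m`.
Convexity makes the line meet `B` in an interval; in a general connected set a slice of constant
`m`-coordinate may be disconnected. -/
theorem eq_of_coord_eq (hB : IsOpen B) (hconv : Convex ℝ B) (hf : DifferentiableOn ℝ f B)
    {m : Fin 3} (h : ∀ i, i ≠ m → ∀ x ∈ B, 𝐃 i f x = 0) {x y : Fin 3 → ℝ} (hx : x ∈ B)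
    (hy : y ∈ B) (hxy : x m = y m) : f x = f y := by
  set L : ℝ →ᵃ[ℝ] (Fin 3 → ℝ) := AffineMap.lineMap x y
  have hL : Continuous L := AffineMap.lineMap_continuous
  have hs : IsOpen (L ⁻¹' B) := IsOpen.preimage hL hB
  have hs' : IsPreconnected (L ⁻¹' B) := (hconv.affine_preimage L).isPreconnected
  have hder : ∀ t ∈ L ⁻¹' B, HasDerivAt (fun t => f (L t)) 0 t := by
    intro t ht
    have h1 : HasDerivAt L (y - x) t := AffineMap.hasDerivAt_lineMap
    have hfd : HasFDerivAt f (fderiv ℝ f (L t)) (L t) :=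
      (hf.differentiableAt (hB.mem_nhds ht)).hasFDerivAt
    have h2 := hfd.comp_hasDerivAt t h1
    have h3 : fderiv ℝ f (L t) (y - x) = 0 := by
      rw [fderiv_apply_eq_sum]
      refine Finset.sum_eq_zero fun i _ => ?_
      by_cases hi : i = m
      · subst hi; simp [hxy]
      · rw [h i hi _ ht, mul_zero]
    rwa [h3] at h2
  have := hs.is_const_of_deriv_eq_zero (𝕜 := ℝ) (f := fun t => f (L t)) hs'
    (fun t ht => (hder t ht).differentiableAt.differentiableWithinAt)
    (fun t ht => (hder t ht).deriv) (x := 0) (y := 1) (by simpa [L] using hx)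
    (by simpa [L] using hy)
  simpa [L] using this

/-- The values of `f` along the parallel lines through `x` and `y` in direction `m` agree near the
two points, so the derivatives agree. No second derivative of `f` is needed, which matters for third
derivatives of a C⁴ function. -/
theorem partialDeriv_eq_of_coord_eq (hB : IsOpen B) (hconv : Convex ℝ B)
    (hf : DifferentiableOn ℝ f B) {m : Fin 3} (h : ∀ i, i ≠ m → ∀ x ∈ B, 𝐃 i f x = 0)
    {x y : Fin 3 → ℝ} (hx : x ∈ B) (hy : y ∈ B) (hxy : x m = y m) : 𝐃 m f x = 𝐃 m f y := by
  have hline : ∀ z ∈ B, 𝐃 m f z = deriv (fun t : ℝ => f (z + t • Pi.single m 1)) 0 :=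
    fun z hz => ((hf.differentiableAt (hB.mem_nhds hz)).lineDeriv_eq_fderiv).symm
  have hmem : ∀ z ∈ B, ∀ᶠ t : ℝ in 𝓝 0, z + t • Pi.single m (1 : ℝ) ∈ B := by
    intro z hz
    have hcont : Continuous fun t : ℝ => z + t • Pi.single m (1 : ℝ) := by fun_prop
    exact hcont.continuousAt.eventually_mem (hB.mem_nhds (by simpa using hz))
  rw [hline x hx, hline y hy]
  apply EventuallyEq.deriv_eq
  filter_upwards [hmem x hx, hmem y hy] with t h1 h2
  exact eq_of_coord_eq hB hconv hf h h1 h2 (by simp [hxy])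

/-- If `a` depends locally only on `x_q`, `b` depends locally only on `x_p`, and
`∂a/∂x_q = ∂b/∂x_p`, then this common derivative is constant. -/
theorem exists_const_of_separated (hΩ : IsOpen Ω) (hc : IsPreconnected Ω) (hpq : p ≠ q)
    (ha : DifferentiableOn ℝ a Ω) (hb : DifferentiableOn ℝ b Ω)
    (ha0 : ∀ i, i ≠ q → ∀ x ∈ Ω, 𝐃 i a x = 0) (hb0 : ∀ i, i ≠ p → ∀ x ∈ Ω, 𝐃 i b x = 0)
    (hab : ∀ x ∈ Ω, 𝐃 q a x = 𝐃 p b x) : ∃ c, ∀ x ∈ Ω, 𝐃 q a x = c := by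
  have hloc : ∀ x ∈ Ω, 𝐃 q a =ᶠ[𝓝 x] fun _ => 𝐃 q a x := by
    intro x hx
    obtain ⟨r, hr, hball⟩ := Metric.isOpen_iff.1 hΩ x hx
    filter_upwards [Metric.ball_mem_nhds x hr] with y hy
    -- The corner `z` shares `x_q` with `y` and every other coordinate, in particular `x_p`, with
    -- `x`. Passing from `y` to `z` uses `a`, passing from `z` to `x` uses `b`. The sup-norm ball is
    -- a box, so it contains `z`.
    set z := Function.update x q (y q) with hz
    have hzb : z ∈ Metric.ball x r := by
      rw [Metric.mem_ball, dist_pi_lt_iff hr] at hy ⊢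
      intro i
      by_cases hi : i = q
      · subst hi; simpa [hz] using hy i
      · simpa [hz, Function.update_of_ne hi] using hr
    have hxb := Metric.mem_ball_self (x := x) hr
    have hz1 : 𝐃 q a y = 𝐃 q a z :=
      partialDeriv_eq_of_coord_eq Metric.isOpen_ball (convex_ball x r) (ha.mono hball)
        (fun i hi w hw => ha0 i hi w (hball hw)) hy hzb (by simp [hz])
    have hz2 : 𝐃 p b z = 𝐃 p b x :=
      partialDeriv_eq_of_coord_eq Metric.isOpen_ball (convex_ball x r) (hb.mono hball)
        (fun i hi w hw => hb0 i hi w (hball hw)) hzb hxb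
        (by simp [hz, Function.update_of_ne hpq])
    rw [hz1, hab z (hball hzb), hz2, hab x hx]
  exact hΩ.exists_is_const_of_fderiv_eq_zero (𝕜 := ℝ) hc
    (fun x hx => ((hloc x hx).differentiableAt_iff.2
      (differentiableAt_const (𝐃 q a x))).differentiableWithinAt)
    (fun x hx => by rw [(hloc x hx).fderiv_eq, fderiv_fun_const])

end LocalConstancy

/-! ### Harmonic functions satisfying the quartic equation -/

section HarmonicQuartic

variable {Ω : Set (Fin 3 → ℝ)} {f g : (Fin 3 → ℝ) → ℝ} {n : ℕ} {k p q : Fin 3}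

theorem partialDeriv_comm_eq_zero (hΩ : IsOpen Ω) (hf : CkOn (n + 2) Ω f) {i : Fin 3}
    (h : ∀ x ∈ Ω, 𝐃 i f x = 0) (j : Fin 3) : ∀ x ∈ Ω, 𝐃 i (𝐃 j f) x = 0 := by
  intro x hx
  rw [partialDeriv_comm hΩ hf i j x hx, partialDeriv_eq_zero hΩ h j x hx]

theorem partialDeriv_eq_neg (hΩ : IsOpen Ω) (h : ∀ x ∈ Ω, f x = -g x) (i : Fin 3) :
    ∀ x ∈ Ω, 𝐃 i f x = -𝐃 i g x := by
  intro x hx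
  rw [partialDeriv_congr hΩ h i x hx, partialDeriv_neg]

/-- A harmonic polynomial in two variables of degree at most four whose quartic part is a multiple
of `y³z - yz³`. -/
noncomputable def harmonicQuartic (κ c₁ c₂ c₃ c₄ c₅ c₆ c₇ y z : ℝ) : ℝ :=
  κ / 6 * (y ^ 3 * z - y * z ^ 3) + c₁ / 6 * (y ^ 3 - 3 * y * z ^ 2) +
    c₂ / 6 * (3 * y ^ 2 * z - z ^ 3) + c₃ / 2 * (y ^ 2 - z ^ 2) + c₄ * y * z + c₅ * y + c₆ * z + c₇

/-- A function of two variables that is harmonic with `∂⁴f/∂x_p⁴ + ∂⁴f/∂x_q⁴ = 0` is a harmonic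
polynomial of degree at most four, without `Re (y + iz)⁴` term. -/
theorem exists_eq_harmonicQuartic (hΩ : IsOpen Ω) (hc : IsPreconnected Ω) (hkp : k ≠ p)
    (hkq : k ≠ q) (hpq : p ≠ q) (hf : CkOn 4 Ω f) (hk : ∀ x ∈ Ω, 𝐃 k f x = 0)
    (hharm : ∀ x ∈ Ω, 𝐃 p (𝐃 p f) x + 𝐃 q (𝐃 q f) x = 0)
    (hquart : ∀ x ∈ Ω, 𝐃 p (𝐃 p (𝐃 p (𝐃 p f))) x + 𝐃 q (𝐃 q (𝐃 q (𝐃 q f))) x = 0) :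
    ∃ κ c₁ c₂ c₃ c₄ c₅ c₆ c₇ : ℝ, ∀ x ∈ Ω,
      f x = harmonicQuartic κ c₁ c₂ c₃ c₄ c₅ c₆ c₇ (x p) (x q) := by
  have hcases : ∀ i : Fin 3, i = k ∨ i = p ∨ i = q := by lia
  have f1 : ∀ i, CkOn 3 Ω (𝐃 i f) := fun i => hf.partialDeriv hΩ i
  have f2 : ∀ i j, CkOn 2 Ω (𝐃 i (𝐃 j f)) := fun i j => (f1 j).partialDeriv hΩ i
  have f3 : ∀ i j l, CkOn 1 Ω (𝐃 i (𝐃 j (𝐃 l f))) := fun i j l => (f2 j l).partialDeriv hΩ i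
  have k1 : ∀ i, ∀ x ∈ Ω, 𝐃 k (𝐃 i f) x = 0 := partialDeriv_comm_eq_zero hΩ hf hk
  have k2 : ∀ i j, ∀ x ∈ Ω, 𝐃 k (𝐃 i (𝐃 j f)) x = 0 := fun i j =>
    partialDeriv_comm_eq_zero hΩ (f1 j) (k1 j) i
  have k3 : ∀ i j l, ∀ x ∈ Ω, 𝐃 k (𝐃 i (𝐃 j (𝐃 l f))) x = 0 := fun i j l =>
    partialDeriv_comm_eq_zero hΩ (f2 j l) (k2 j l) i
  have hqq : ∀ x ∈ Ω, 𝐃 q (𝐃 q f) x = -𝐃 p (𝐃 p f) x := fun x hx => by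
    linarith [hharm x hx]
  have hqp : ∀ x ∈ Ω, 𝐃 q (𝐃 p f) x = 𝐃 p (𝐃 q f) x := partialDeriv_comm hΩ hf q p
  -- By harmonicity `a` and `b` determine all third derivatives in `p`, `q`, and ∂_q a = ∂_p b, ∂_q
  -- b = -∂_p a. The quartic equation becomes 2 ∂_p a = 0, so `a` depends locally only on `x_q` and
  -- `b` only on `x_p`, and their common derivative is the constant κ.
  set a := 𝐃 p (𝐃 p (𝐃 p f)) with ha
  set b := 𝐃 q (𝐃 p (𝐃 p f)) with hb
  have ppq : ∀ x ∈ Ω, 𝐃 p (𝐃 q (𝐃 p f)) x = b x := fun x hx =>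
    (partialDeriv_comm hΩ (f1 p) q p x hx).symm
  have qpq : ∀ x ∈ Ω, 𝐃 q (𝐃 q (𝐃 p f)) x = -a x := fun x hx => by
    rw [partialDeriv_congr hΩ hqp q x hx, partialDeriv_comm hΩ (f1 q) q p x hx,
      partialDeriv_eq_neg hΩ hqq p x hx]
  have hqa : ∀ x ∈ Ω, 𝐃 q a x = 𝐃 p b x := partialDeriv_comm hΩ (f2 p p) q p
  have hqb : ∀ x ∈ Ω, 𝐃 q b x = -𝐃 p a x := fun x hx => by
    rw [← partialDeriv_congr hΩ ppq q x hx, partialDeriv_comm hΩ (f2 q p) q p x hx,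
      partialDeriv_eq_neg hΩ qpq p x hx]
  have hq4 : ∀ x ∈ Ω, 𝐃 q (𝐃 q (𝐃 q (𝐃 q f))) x = -𝐃 q b x :=
    partialDeriv_eq_neg hΩ (partialDeriv_eq_neg hΩ hqq q) q
  have hpa : ∀ x ∈ Ω, 𝐃 p a x = 0 := fun x hx => by
    have := hquart x hx
    rw [hq4 x hx, hqb x hx] at this
    linarith
  have hqb0 : ∀ x ∈ Ω, 𝐃 q b x = 0 := fun x hx => by rw [hqb x hx, hpa x hx, neg_zero]
  have dOn : ∀ {m : ℕ} {h : (Fin 3 → ℝ) → ℝ}, CkOn (m + 1) Ω h → DifferentiableOn ℝ h Ω :=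
    fun hh x hx => (hh.differentiableAt hΩ hx).differentiableWithinAt
  obtain ⟨κ, hκ⟩ := exists_const_of_separated hΩ hc hpq (dOn (f3 p p p)) (dOn (f3 q p p))
    (fun i hi x hx => by
      rcases hcases i with rfl | rfl | rfl
      exacts [k3 _ _ _ x hx, hpa x hx, absurd rfl hi])
    (fun i hi x hx => by
      rcases hcases i with rfl | rfl | rfl
      exacts [k3 _ _ _ x hx, absurd rfl hi, hqb0 x hx]) hqa
  have hκ' : ∀ x ∈ Ω, 𝐃 p b x = κ := fun x hx => by rw [← hqa x hx, hκ x hx]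
  -- integrate from the third derivatives down to `f`
  have integrate : ∀ {m : ℕ} {h P : (Fin 3 → ℝ) → ℝ}, CkOn (m + 1) Ω h → Differentiable ℝ P →
      (∀ x ∈ Ω, 𝐃 k h x = 𝐃 k P x) → (∀ x ∈ Ω, 𝐃 p h x = 𝐃 p P x) →
      (∀ x ∈ Ω, 𝐃 q h x = 𝐃 q P x) → ∃ c, ∀ x ∈ Ω, h x = P x + c := by
    intro m h P hh hP h0 h1 h2
    refine exists_eq_add_const hΩ hc (dOn hh) hP fun i => ?_
    rcases hcases i with rfl | rfl | rfl
    exacts [h0, h1, h2]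
  have hpk := hkp.symm
  have hqk := hkq.symm
  have hqp' := hpq.symm
  -- Each `P` below is an antiderivative of the expressions found one order higher, with harmonicity
  -- supplying the derivatives not computed directly; every integration adds one constant.
  obtain ⟨c₁, h₁⟩ := integrate (P := fun x => κ * x q) (f3 p p p) (by fun_prop)
    (fun x hx => by
      rw [k3 _ _ _ x hx]
      simp (disch := fun_prop) [partialDeriv_mul, partialDeriv_coord, partialDeriv_const, *])
    (fun x hx => by
      rw [hpa x hx]
      simp (disch := fun_prop) [partialDeriv_mul, partialDeriv_coord, partialDeriv_const, hqp'])
    (fun x hx => by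
      rw [hκ x hx]
      simp (disch := fun_prop) [partialDeriv_mul, partialDeriv_coord, partialDeriv_const])
  obtain ⟨c₂, h₂⟩ := integrate (P := fun x => κ * x p) (f3 q p p) (by fun_prop)
    (fun x hx => by
      rw [k3 _ _ _ x hx]
      simp (disch := fun_prop) [partialDeriv_mul, partialDeriv_coord, partialDeriv_const, hpk])
    (fun x hx => by
      rw [hκ' x hx]
      simp (disch := fun_prop) [partialDeriv_mul, partialDeriv_coord, partialDeriv_const])
    (fun x hx => by
      rw [hqb0 x hx]
      simp (disch := fun_prop) [partialDeriv_mul, partialDeriv_coord, partialDeriv_const, hpq])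
  obtain ⟨c₃, h₃⟩ := integrate (P := fun x => κ * x p * x q + c₁ * x p + c₂ * x q) (f2 p p)
    (by fun_prop)
    (fun x hx => by
      rw [k2 _ _ x hx]
      simp (disch := fun_prop) [partialDeriv_add, partialDeriv_mul, partialDeriv_coord,
        partialDeriv_const, hpk, hqk])
    (fun x hx => by
      rw [h₁ x hx]
      simp (disch := fun_prop) [partialDeriv_add, partialDeriv_mul, partialDeriv_coord,
        partialDeriv_const, hqp'])
    (fun x hx => by
      rw [h₂ x hx]
      simp (disch := fun_prop) [partialDeriv_add, partialDeriv_mul, partialDeriv_coord,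
        partialDeriv_const, hpq])
  obtain ⟨c₄, h₄⟩ := integrate
    (P := fun x => κ / 2 * (x p ^ 2 - x q ^ 2) + c₂ * x p - c₁ * x q) (f2 q p)
    (by fun_prop)
    (fun x hx => by
      rw [k2 _ _ x hx]
      simp (disch := fun_prop) [partialDeriv_add, partialDeriv_sub, partialDeriv_mul,
        partialDeriv_sq, partialDeriv_coord, partialDeriv_const, hpk, hqk])
    (fun x hx => by
      rw [ppq x hx, hb, h₂ x hx]
      simp (disch := fun_prop) [partialDeriv_add, partialDeriv_sub, partialDeriv_mul,
        partialDeriv_sq, partialDeriv_coord, partialDeriv_const, hqp']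
      ring)
    (fun x hx => by
      rw [qpq x hx, ha, h₁ x hx]
      simp (disch := fun_prop) [partialDeriv_add, partialDeriv_sub, partialDeriv_mul,
        partialDeriv_sq, partialDeriv_coord, partialDeriv_const, hpq]
      ring)
  obtain ⟨c₅, h₅⟩ := integrate
    (P := fun x => κ / 2 * (x p ^ 2 * x q) - κ / 6 * x q ^ 3 + c₁ / 2 * (x p ^ 2 - x q ^ 2) +
      c₂ * x p * x q + c₃ * x p + c₄ * x q) (f1 p)
    (by fun_prop)
    (fun x hx => by
      rw [k1 _ x hx]
      simp (disch := fun_prop) [partialDeriv_add, partialDeriv_sub, partialDeriv_mul,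
        partialDeriv_sq, partialDeriv_cube, partialDeriv_coord, partialDeriv_const, hpk, hqk])
    (fun x hx => by
      rw [h₃ x hx]
      simp (disch := fun_prop) [partialDeriv_add, partialDeriv_sub, partialDeriv_mul,
        partialDeriv_sq, partialDeriv_cube, partialDeriv_coord, partialDeriv_const, hqp']
      ring)
    (fun x hx => by
      rw [h₄ x hx]
      simp (disch := fun_prop) [partialDeriv_add, partialDeriv_sub, partialDeriv_mul,
        partialDeriv_sq, partialDeriv_cube, partialDeriv_coord, partialDeriv_const, hpq]
      ring)
  obtain ⟨c₆, h₆⟩ := integrate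
    (P := fun x => κ / 6 * x p ^ 3 - κ / 2 * (x p * x q ^ 2) + c₂ / 2 * (x p ^ 2 - x q ^ 2) -
      c₁ * x p * x q + c₄ * x p - c₃ * x q) (f1 q)
    (by fun_prop)
    (fun x hx => by
      rw [k1 _ x hx]
      simp (disch := fun_prop) [partialDeriv_add, partialDeriv_sub, partialDeriv_mul,
        partialDeriv_sq, partialDeriv_cube, partialDeriv_coord, partialDeriv_const, hpk, hqk])
    (fun x hx => by
      rw [← hqp x hx, h₄ x hx]
      simp (disch := fun_prop) [partialDeriv_add, partialDeriv_sub, partialDeriv_mul,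
        partialDeriv_sq, partialDeriv_cube, partialDeriv_coord, partialDeriv_const, hqp']
      ring)
    (fun x hx => by
      rw [hqq x hx, h₃ x hx]
      simp (disch := fun_prop) [partialDeriv_add, partialDeriv_sub, partialDeriv_mul,
        partialDeriv_sq, partialDeriv_cube, partialDeriv_coord, partialDeriv_const, hpq]
      ring)
  obtain ⟨c₇, h₇⟩ := integrate
    (P := fun x => κ / 6 * (x p ^ 3 * x q - x p * x q ^ 3) +
      c₁ / 6 * (x p ^ 3 - 3 * x p * x q ^ 2) + c₂ / 6 * (3 * x p ^ 2 * x q - x q ^ 3) +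
      c₃ / 2 * (x p ^ 2 - x q ^ 2) + c₄ * x p * x q + c₅ * x p + c₆ * x q) hf
    (by fun_prop)
    (fun x hx => by
      rw [hk x hx]
      simp (disch := fun_prop) [partialDeriv_add, partialDeriv_sub, partialDeriv_mul,
        partialDeriv_sq, partialDeriv_cube, partialDeriv_coord, partialDeriv_const, hpk, hqk])
    (fun x hx => by
      rw [h₅ x hx]
      simp (disch := fun_prop) [partialDeriv_add, partialDeriv_sub, partialDeriv_mul,
        partialDeriv_sq, partialDeriv_cube, partialDeriv_coord, partialDeriv_const, hqp']
      ring)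
    (fun x hx => by
      rw [h₆ x hx]
      simp (disch := fun_prop) [partialDeriv_add, partialDeriv_sub, partialDeriv_mul,
        partialDeriv_sq, partialDeriv_cube, partialDeriv_coord, partialDeriv_const, hpq]
      ring)
  exact ⟨κ, c₁, c₂, c₃, c₄, c₅, c₆, c₇, fun x hx => by rw [h₇ x hx, harmonicQuartic]⟩

end HarmonicQuartic

/-! ### Harmonic quartics and separated sums, one variable at a time -/

section OneVariable

theorem iteratedDeriv_two_cubic (a b c d : ℝ) :
    iteratedDeriv 2 (fun s : ℝ => a * s ^ 3 + b * s ^ 2 + c * s + d) =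
      fun s => 6 * a * s + 2 * b := by
  have h1 : deriv (fun s : ℝ => a * s ^ 3 + b * s ^ 2 + c * s + d) =
      fun s => 3 * a * s ^ 2 + 2 * b * s + c := by
    funext s
    simp (disch := fun_prop) [deriv_fun_add]
    ring
  have h2 : deriv (fun s : ℝ => 3 * a * s ^ 2 + 2 * b * s + c) =
      fun s => 6 * a * s + 2 * b := by
    funext s
    simp (disch := fun_prop) [deriv_fun_add]
    ring
  rw [iteratedDeriv_succ, iteratedDeriv_one, h1, h2]

theorem iteratedDeriv_four_cubic (a b c d : ℝ) :
    iteratedDeriv 4 (fun s : ℝ => a * s ^ 3 + b * s ^ 2 + c * s + d) = fun _ => 0 := by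
  have h3 : deriv (fun s : ℝ => 6 * a * s + 2 * b) = fun _ => 6 * a := by
    funext s
    simp (disch := fun_prop) [deriv_fun_add]
  rw [iteratedDeriv_succ, iteratedDeriv_succ, iteratedDeriv_two_cubic, h3]
  simp

/-- Since y³z - yz³ has degree three in each variable, every slice is a cubic: its second derivative
is explicit and its fourth vanishes. -/
theorem harmonicQuartic_left (κ c₁ c₂ c₃ c₄ c₅ c₆ c₇ z : ℝ) :
    (fun s => harmonicQuartic κ c₁ c₂ c₃ c₄ c₅ c₆ c₇ s z) = fun s =>
      (κ / 6 * z + c₁ / 6) * s ^ 3 + (c₂ / 2 * z + c₃ / 2) * s ^ 2 +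
        (-κ / 6 * z ^ 3 - c₁ / 2 * z ^ 2 + c₄ * z + c₅) * s +
        (-c₂ / 6 * z ^ 3 - c₃ / 2 * z ^ 2 + c₆ * z + c₇) := by
  funext s; rw [harmonicQuartic]; ring

theorem harmonicQuartic_right (κ c₁ c₂ c₃ c₄ c₅ c₆ c₇ y : ℝ) :
    (fun t => harmonicQuartic κ c₁ c₂ c₃ c₄ c₅ c₆ c₇ y t) = fun t =>
      (-κ / 6 * y - c₂ / 6) * t ^ 3 + (-c₁ / 2 * y - c₃ / 2) * t ^ 2 +
        (κ / 6 * y ^ 3 + c₂ / 2 * y ^ 2 + c₄ * y + c₆) * t +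
        (c₁ / 6 * y ^ 3 + c₃ / 2 * y ^ 2 + c₅ * y + c₇) := by
  funext t; rw [harmonicQuartic]; ring

theorem isHarmonic_harmonicQuartic (κ c₁ c₂ c₃ c₄ c₅ c₆ c₇ : ℝ) :
    IsHarmonic (harmonicQuartic κ c₁ c₂ c₃ c₄ c₅ c₆ c₇) := by
  refine ⟨?_, fun y z => ?_⟩
  · have : Function.uncurry (harmonicQuartic κ c₁ c₂ c₃ c₄ c₅ c₆ c₇) =
        fun v : ℝ × ℝ => harmonicQuartic κ c₁ c₂ c₃ c₄ c₅ c₆ c₇ v.1 v.2 := rfl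
    rw [this]
    unfold harmonicQuartic
    fun_prop
  · rw [harmonicQuartic_left, harmonicQuartic_right, iteratedDeriv_two_cubic,
      iteratedDeriv_two_cubic]
    ring

theorem fourthOrderRepresentation_harmonicQuartic (κ c₁ c₂ c₃ c₄ c₅ c₆ c₇ : ℝ) :
    FourthOrderRepresentation (harmonicQuartic κ c₁ c₂ c₃ c₄ c₅ c₆ c₇) := by
  -- The monomials are sorted by their degree in z: degree 0 into `f`, degree 1 into `k`; the
  -- others, of degree 0 or 1 in y, go into `h` and `l`. The zero coefficients keep each function in
  -- the shape of `iteratedDeriv_four_cubic`.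
  refine ⟨fun y => c₁ / 6 * y ^ 3 + c₃ / 2 * y ^ 2 + c₅ * y + c₇,
    fun y => κ / 6 * y ^ 3 + c₂ / 2 * y ^ 2 + c₄ * y + 0,
    fun z => -c₂ / 6 * z ^ 3 + -c₃ / 2 * z ^ 2 + c₆ * z + 0,
    fun z => -κ / 6 * z ^ 3 + -c₁ / 2 * z ^ 2 + 0 * z + 0,
    by fun_prop, by fun_prop, by fun_prop, by fun_prop, fun y z => ?_, fun y z => ?_⟩
  · rw [harmonicQuartic]; ring
  · simp only [iteratedDeriv_four_cubic]; ring

/-- In either variable a separated sum is two functions of that variable plus an affine remainder,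
which derivatives of order at least two annihilate. -/
theorem iteratedDeriv_add_mul_add {n : ℕ} {f k : ℝ → ℝ} (hf : ContDiff ℝ n f)
    (hk : ContDiff ℝ n k) (hn : 2 ≤ n) (y c d x : ℝ) :
    iteratedDeriv n (fun s => f s + y * k s + c + s * d) x =
      iteratedDeriv n f x + y * iteratedDeriv n k x := by
  have hlin : iteratedDeriv n (fun s : ℝ => c + s * d) x = 0 := by
    obtain ⟨m, rfl⟩ := Nat.exists_eq_add_of_le' hn
    have : deriv (fun s : ℝ => c + s * d) = fun _ => d := by funext s; simp
    rw [iteratedDeriv_succ', this, iteratedDeriv_const]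
    simp
  have : (fun s => f s + y * k s + c + s * d) =
      (f + fun s => y * k s) + fun s => c + s * d := by
    funext s; simp only [Pi.add_apply]; ring
  have hk' : ContDiff ℝ n (fun s => y * k s) := by fun_prop
  rw [this, iteratedDeriv_add (f := f + fun s => y * k s) (hf.add hk').contDiffAt (by fun_prop),
    iteratedDeriv_add hf.contDiffAt hk'.contDiffAt, hlin,
    iteratedDeriv_const_mul_field]
  simp

theorem FourthOrderRepresentation.fourthOrderPDEs {g : ℝ → ℝ → ℝ}
    (hg : FourthOrderRepresentation g) : FourthOrderPDEs g := by
  obtain ⟨f, k, h, l, hf, hk, hh, hl, hrep, h4⟩ := hg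
  have hx : ∀ y, (fun s => g s y) = fun s => f s + y * k s + h y + s * l y := fun y =>
    funext fun s => hrep s y
  have hy : ∀ x, (fun t => g x t) = fun t => h t + x * l t + f x + t * k x := fun x =>
    funext fun t => by rw [hrep]; ring
  refine ⟨fun x y => ?_, fun x y => ?_⟩
  -- The second derivative in the second variable is h'' + s l'', affine in s; it is written as a
  -- degenerate cubic.
  · have : (fun s => iteratedDeriv 2 (fun t => g s t) y) =
        fun s => 0 * s ^ 3 + 0 * s ^ 2 + iteratedDeriv 2 l y * s + iteratedDeriv 2 h y := by
      funext s
      rw [hy, iteratedDeriv_add_mul_add (n := 2) (hh.of_le (by norm_num))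
        (hl.of_le (by norm_num)) le_rfl]
      ring
    rw [this, iteratedDeriv_two_cubic]
    simp
  · rw [hx, hy, iteratedDeriv_add_mul_add (n := 4) hf hk (by norm_num),
      iteratedDeriv_add_mul_add (n := 4) hh hl (by norm_num)]
    linarith [h4 x y]

end OneVariable

/-! ### Functions on the plane as functions on ℝ³ -/

section Plane

theorem contDiff_plane {g : ℝ → ℝ → ℝ} (hg : ContDiff ℝ 4 (Function.uncurry g)) (p q : Fin 3) :
    ContDiff ℝ 4 fun x : Fin 3 → ℝ => g (x p) (x q) :=
  hg.comp (f := fun x : Fin 3 → ℝ => (x p, x q)) (by fun_prop)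

variable {g : ℝ → ℝ → ℝ} {k p q : Fin 3}

theorem partialDeriv_plane_eq_zero (hg : ContDiff ℝ 4 (Function.uncurry g)) (hkp : k ≠ p)
    (hkq : k ≠ q) (x : Fin 3 → ℝ) : 𝐃 k (fun x => g (x p) (x q)) x = 0 := by
  have h := iterate_partialDeriv_eq_iteratedDeriv k 1 _ ((contDiff_plane hg p q).of_le
    (by norm_num)) x
  simpa [Function.update_of_ne hkp.symm, Function.update_of_ne hkq.symm] using h

theorem laplacian_plane_eq_zero (hg : IsHarmonic g) (hpq : p ≠ q) (x : Fin 3 → ℝ) :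
    𝐃 p (𝐃 p fun x => g (x p) (x q)) x + 𝐃 q (𝐃 q fun x => g (x p) (x q)) x = 0 := by
  have hs : ContDiff ℝ (2 : ℕ) fun x : Fin 3 → ℝ => g (x p) (x q) :=
    (contDiff_plane hg.1 p q).of_le (by norm_num)
  have h1 := iterate_partialDeriv_eq_iteratedDeriv p 2 _ hs x
  have h2 := iterate_partialDeriv_eq_iteratedDeriv q 2 _ hs x
  simp only [Function.iterate_succ, Function.iterate_zero, Function.comp_apply, id,
    Function.update_self, Function.update_of_ne hpq, Function.update_of_ne hpq.symm] at h1 h2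
  rw [h1, h2]
  exact hg.2 _ _

theorem quartic_plane_eq_zero (hg : ContDiff ℝ 4 (Function.uncurry g)) (h4 : FourthOrderPDEs g)
    (hpq : p ≠ q) (x : Fin 3 → ℝ) :
    𝐃 p (𝐃 p (𝐃 p (𝐃 p fun x => g (x p) (x q)))) x +
      𝐃 q (𝐃 q (𝐃 q (𝐃 q fun x => g (x p) (x q)))) x = 0 := by
  have hs : ContDiff ℝ (4 : ℕ) fun x : Fin 3 → ℝ => g (x p) (x q) := contDiff_plane hg p q
  have h1 := iterate_partialDeriv_eq_iteratedDeriv p 4 _ hs x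
  have h2 := iterate_partialDeriv_eq_iteratedDeriv q 4 _ hs x
  simp only [Function.iterate_succ, Function.iterate_zero, Function.comp_apply, id,
    Function.update_self, Function.update_of_ne hpq, Function.update_of_ne hpq.symm] at h1 h2
  rw [h1, h2]
  exact h4.2 _ _

theorem IsHarmonic.fourthOrderRepresentation (hg : IsHarmonic g) (h4 : FourthOrderPDEs g) :
    FourthOrderRepresentation g := by
  obtain ⟨κ, c₁, c₂, c₃, c₄, c₅, c₆, c₇, h⟩ := exists_eq_harmonicQuartic (k := 0) (p := 1) (q := 2)
    isOpen_univ isPreconnected_univ (by decide) (by decide) (by decide)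
    (contDiff_plane hg.1 1 2).contDiffOn
    (fun x _ => partialDeriv_plane_eq_zero hg.1 (by decide) (by decide) x)
    (fun x _ => laplacian_plane_eq_zero hg (by decide) x)
    (fun x _ => quartic_plane_eq_zero hg.1 h4 (by decide) x)
  have : g = harmonicQuartic κ c₁ c₂ c₃ c₄ c₅ c₆ c₇ := by
    funext y z
    simpa using h ![0, y, z] trivial
  rw [this]
  exact fourthOrderRepresentation_harmonicQuartic ..

end Plane

/-! ### The system of differential equations behind universality -/

theorem sum_eq_of_distinct {k p q : Fin 3} (hkp : k ≠ p) (hkq : k ≠ q) (hpq : p ≠ q)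
    (F : Fin 3 → ℝ) : ∑ i, F i = F k + F p + F q := by
  have : (Finset.univ : Finset (Fin 3)) = {k, p, q} := by
    revert k p q; decide
  rw [this, Finset.sum_insert (by simp [hkp, hkq]), Finset.sum_insert (by simp [hpq]),
    Finset.sum_singleton]
  ring

/-- The partial differential equations equivalent to universality for cubic materials. -/
structure CubicUniversalityPDEs (Ω : Set (Fin 3 → ℝ)) (u : (Fin 3 → ℝ) → Fin 3 → ℝ) : Prop where
  pure : ∀ k, ∀ x ∈ Ω, 𝐃 k (𝐃 k fun y => u y k) x = 0
  harmonic : ∀ k, ∀ x ∈ Ω, ∑ i, 𝐃 i (𝐃 i fun y => u y k) x = 0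
  div_const : ∀ k, ∀ x ∈ Ω, ∑ l, 𝐃 k (𝐃 l fun y => u y l) x = 0
  quartic : ∀ k, ∀ x ∈ Ω, ∑ i, 𝐃 i (𝐃 i (𝐃 i (𝐃 i fun y => u y k))) x = 0

section Calculus

variable {Ω : Set (Fin 3 → ℝ)} {f g : (Fin 3 → ℝ) → ℝ} {n : ℕ}

theorem CkOn.differentiableOn (hf : CkOn (n + 1) Ω f) (hΩ : IsOpen Ω) : DifferentiableOn ℝ f Ω :=
  fun _ hx => (hf.differentiableAt hΩ hx).differentiableWithinAt

theorem partialDeriv_add_on (hΩ : IsOpen Ω) (hf : CkOn (n + 1) Ω f) (hg : CkOn (n + 1) Ω g)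
    (i : Fin 3) : ∀ x ∈ Ω, 𝐃 i (fun y => f y + g y) x = 𝐃 i f x + 𝐃 i g x := fun _ hx =>
  partialDeriv_add_apply (hf.differentiableAt hΩ hx) (hg.differentiableAt hΩ hx) i

theorem partialDeriv_add_on_two (hΩ : IsOpen Ω) (hf : CkOn (n + 2) Ω f) (hg : CkOn (n + 2) Ω g)
    (i j : Fin 3) :
    ∀ x ∈ Ω, 𝐃 i (𝐃 j fun y => f y + g y) x = 𝐃 i (𝐃 j f) x + 𝐃 i (𝐃 j g) x := fun x hx => by
  rw [partialDeriv_congr hΩ (partialDeriv_add_on hΩ hf hg j) i x hx,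
    partialDeriv_add_on hΩ (hf.partialDeriv hΩ j) (hg.partialDeriv hΩ j) i x hx]

theorem partialDeriv_add_on_four (hΩ : IsOpen Ω) (hf : CkOn (n + 4) Ω f)
    (hg : CkOn (n + 4) Ω g) (i j l m : Fin 3) :
    ∀ x ∈ Ω, 𝐃 i (𝐃 j (𝐃 l (𝐃 m fun y => f y + g y))) x =
      𝐃 i (𝐃 j (𝐃 l (𝐃 m f))) x + 𝐃 i (𝐃 j (𝐃 l (𝐃 m g))) x := fun x hx => by
  rw [partialDeriv_congr hΩ (partialDeriv_congr hΩ (partialDeriv_add_on_two hΩ hf hg l m) j) i x hx,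
    partialDeriv_add_on_two hΩ ((hf.partialDeriv hΩ m).partialDeriv hΩ l)
      ((hg.partialDeriv hΩ m).partialDeriv hΩ l) i j x hx]

end Calculus

/-! ### Integration of the system -/

namespace CubicUniversalityPDEs

variable {Ω : Set (Fin 3 → ℝ)} {u : (Fin 3 → ℝ) → Fin 3 → ℝ} {k p q : Fin 3}

/-- `∂²/∂x_p∂x_q` annihilates each normal strain, for `p ≠ q`. -/
theorem mixed (h : CubicUniversalityPDEs Ω u) (hΩ : IsOpen Ω)
    (hu : ∀ k, CkOn 4 Ω fun y => u y k) (hkp : k ≠ p) (hkq : k ≠ q) (hpq : p ≠ q) :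
    ∀ x ∈ Ω, 𝐃 q (𝐃 p (𝐃 k fun y => u y k)) x = 0 := by
  have u1 : ∀ l m, CkOn 3 Ω (𝐃 l fun y => u y m) := fun l m => (hu m).partialDeriv hΩ l
  have u2 : ∀ i l m, CkOn 2 Ω (𝐃 i (𝐃 l fun y => u y m)) := fun i l m =>
    (u1 l m).partialDeriv hΩ i
  intro x hx
  have h1 : ∑ l, 𝐃 q (𝐃 p (𝐃 l fun y => u y l)) x = 0 := by
    rw [← partialDeriv_sum_apply (fun l _ => (u2 p l l).differentiableAt hΩ hx)]
    exact partialDeriv_eq_zero hΩ (h.div_const p) q x hx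
  -- In ∂_q∂_p div u the terms of u_p and u_q contain ∂_p²u_p and ∂_q²u_q, so only the term of u_k
  -- survives.
  rw [sum_eq_of_distinct hkp hkq hpq, partialDeriv_eq_zero hΩ (h.pure p) q x hx,
    partialDeriv_comm hΩ (u1 q q) q p x hx, partialDeriv_eq_zero hΩ (h.pure q) p x hx] at h1
  linarith

/-- Differentiate Δu_k = 0 along `k`; the term ∂_k³u_k drops out. -/
theorem harmonic_normal (h : CubicUniversalityPDEs Ω u) (hΩ : IsOpen Ω)
    (hu : ∀ k, CkOn 4 Ω fun y => u y k) (hkp : k ≠ p) (hkq : k ≠ q) (hpq : p ≠ q) :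
    ∀ x ∈ Ω, 𝐃 p (𝐃 p (𝐃 k fun y => u y k)) x + 𝐃 q (𝐃 q (𝐃 k fun y => u y k)) x = 0 := by
  have u1 : ∀ l m, CkOn 3 Ω (𝐃 l fun y => u y m) := fun l m => (hu m).partialDeriv hΩ l
  have u2 : ∀ i l m, CkOn 2 Ω (𝐃 i (𝐃 l fun y => u y m)) := fun i l m =>
    (u1 l m).partialDeriv hΩ i
  have hcomm : ∀ i, ∀ x ∈ Ω, 𝐃 k (𝐃 i (𝐃 i fun y => u y k)) x =
      𝐃 i (𝐃 i (𝐃 k fun y => u y k)) x := fun i x hx => by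
    rw [partialDeriv_comm hΩ (u1 i k) k i x hx,
      partialDeriv_congr hΩ (partialDeriv_comm hΩ (hu k) k i) i x hx]
  intro x hx
  have h1 : ∑ i, 𝐃 k (𝐃 i (𝐃 i fun y => u y k)) x = 0 := by
    rw [← partialDeriv_sum_apply (fun i _ => (u2 i i k).differentiableAt hΩ hx)]
    exact partialDeriv_eq_zero hΩ (h.harmonic k) k x hx
  rw [sum_eq_of_distinct hkp hkq hpq, partialDeriv_eq_zero hΩ (h.pure k) k x hx,
    hcomm p x hx, hcomm q x hx] at h1
  linarith

/-- Each normal strain is a quadratic polynomial. -/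
theorem exists_normal_eq (h : CubicUniversalityPDEs Ω u) (hΩ : IsOpen Ω) (hc : IsPreconnected Ω)
    (hu : ∀ k, CkOn 4 Ω fun y => u y k) (hkp : k ≠ p) (hkq : k ≠ q) (hpq : p ≠ q) :
    ∃ m b c d : ℝ, ∀ x ∈ Ω, 𝐃 k (fun y => u y k) x =
      m / 2 * (x q ^ 2 - x p ^ 2) + b * x p + c * x q + d := by
  have hcases : ∀ i : Fin 3, i = k ∨ i = p ∨ i = q := by lia
  have hpk := hkp.symm
  have hqk := hkq.symm
  have hqp := hpq.symm
  have hα : CkOn 3 Ω (𝐃 k fun y => u y k) := (hu k).partialDeriv hΩ k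
  have hpq0 := h.mixed hΩ hu hkp hkq hpq
  have hqp0 := h.mixed hΩ hu hkq hkp hqp
  have hlap := h.harmonic_normal hΩ hu hkp hkq hpq
  have hk0 := h.pure k
  set α := 𝐃 k fun y => u y k
  have hk1 := fun i => partialDeriv_comm_eq_zero hΩ hα hk0 i
  have integrate : ∀ {n : ℕ} {f P : (Fin 3 → ℝ) → ℝ}, CkOn (n + 1) Ω f → Differentiable ℝ P →
      (∀ x ∈ Ω, 𝐃 k f x = 𝐃 k P x) → (∀ x ∈ Ω, 𝐃 p f x = 𝐃 p P x) →
      (∀ x ∈ Ω, 𝐃 q f x = 𝐃 q P x) → ∃ c, ∀ x ∈ Ω, f x = P x + c := by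
    intro n f P hf hP h0 h1 h2
    refine exists_eq_add_const hΩ hc (hf.differentiableOn hΩ) hP fun i => ?_
    rcases hcases i with rfl | rfl | rfl
    exacts [h0, h1, h2]
  have hneg : ∀ i, ∀ x ∈ Ω, 𝐃 i (fun y => -𝐃 p α y) x = -𝐃 i (𝐃 p α) x := fun i x _ => by
    rw [partialDeriv_neg]
  -- The mixed derivative vanishes, so ∂_qα depends locally only on `x_q` and -∂_pα only on `x_p`;
  -- harmonicity matches their derivatives.
  obtain ⟨m, hm⟩ := exists_const_of_separated (a := 𝐃 q α) (b := fun x => -𝐃 p α x) hΩ hc hpq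
    ((hα.partialDeriv hΩ q).differentiableOn hΩ)
    ((hα.partialDeriv hΩ p).differentiableOn hΩ).neg
    (fun i hi x hx => by
      rcases hcases i with rfl | rfl | rfl
      exacts [hk1 _ x hx, hqp0 x hx, absurd rfl hi])
    (fun i hi x hx => by
      rw [hneg i x hx, neg_eq_zero]
      rcases hcases i with rfl | rfl | rfl
      exacts [hk1 _ x hx, absurd rfl hi, hpq0 x hx])
    (fun x hx => by rw [hneg p x hx]; linarith [hlap x hx])
  obtain ⟨b, hb⟩ := integrate (P := fun x => -m * x p) (hα.partialDeriv hΩ p) (by fun_prop)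
    (fun x hx => by
      rw [hk1 _ x hx]
      simp (disch := fun_prop) [partialDeriv_neg, partialDeriv_mul, partialDeriv_coord, partialDeriv_const, hpk])
    (fun x hx => by
      have := hlap x hx
      rw [hm x hx] at this
      simp (disch := fun_prop) [partialDeriv_neg, partialDeriv_mul, partialDeriv_coord, partialDeriv_const]
      linarith)
    (fun x hx => by
      rw [hpq0 x hx]
      simp (disch := fun_prop) [partialDeriv_neg, partialDeriv_mul, partialDeriv_coord, partialDeriv_const, hpq])
  obtain ⟨c, hc'⟩ := integrate (P := fun x => m * x q) (hα.partialDeriv hΩ q) (by fun_prop)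
    (fun x hx => by
      rw [hk1 _ x hx]
      simp (disch := fun_prop) [partialDeriv_mul, partialDeriv_coord, partialDeriv_const, hqk])
    (fun x hx => by
      rw [hqp0 x hx]
      simp (disch := fun_prop) [partialDeriv_mul, partialDeriv_coord, partialDeriv_const, hqp])
    (fun x hx => by
      rw [hm x hx]
      simp (disch := fun_prop) [partialDeriv_mul, partialDeriv_coord, partialDeriv_const])
  obtain ⟨d, hd⟩ := integrate
    (P := fun x => m / 2 * (x q ^ 2 - x p ^ 2) + b * x p + c * x q) hα (by fun_prop)
    (fun x hx => by
      rw [hk0 x hx]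
      simp (disch := fun_prop) [partialDeriv_add, partialDeriv_sub, partialDeriv_mul,
        partialDeriv_sq, partialDeriv_coord, partialDeriv_const, hpk, hqk])
    (fun x hx => by
      rw [hb x hx]
      simp (disch := fun_prop) [partialDeriv_add, partialDeriv_sub, partialDeriv_mul,
        partialDeriv_sq, partialDeriv_coord, partialDeriv_const, hqp]
      ring)
    (fun x hx => by
      rw [hc' x hx]
      simp (disch := fun_prop) [partialDeriv_add, partialDeriv_sub, partialDeriv_mul,
        partialDeriv_sq, partialDeriv_coord, partialDeriv_const, hpq]
      ring)
  exact ⟨m, b, c, d, hd⟩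

/-- Subtracting x_k u_{k,k} from u_k leaves something independent of x_k. The subtracted term is
itself harmonic, as x_q² - x_p² is, and its pure fourth derivatives vanish, so
`exists_eq_harmonicQuartic` applies to the remainder. -/
theorem exists_component_eq (h : CubicUniversalityPDEs Ω u) (hΩ : IsOpen Ω)
    (hc : IsPreconnected Ω) (hu : ∀ k, CkOn 4 Ω fun y => u y k) (hkp : k ≠ p) (hkq : k ≠ q)
    (hpq : p ≠ q) :
    ∃ m b c d κ c₁ c₂ c₃ c₄ c₅ c₆ c₇ : ℝ, ∀ x ∈ Ω,
      𝐃 k (fun y => u y k) x = m / 2 * (x q ^ 2 - x p ^ 2) + b * x p + c * x q + d ∧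
      u x k = x k * (m / 2 * (x q ^ 2 - x p ^ 2) + b * x p + c * x q + d) +
        harmonicQuartic κ c₁ c₂ c₃ c₄ c₅ c₆ c₇ (x p) (x q) := by
  have hpk := hkp.symm
  have hqk := hkq.symm
  have hqp := hpq.symm
  obtain ⟨m, b, c, d, hα⟩ := h.exists_normal_eq hΩ hc hu hkp hkq hpq
  have hlap := h.harmonic k
  have hquart := h.quartic k
  have hk0 := h.pure k
  simp only [sum_eq_of_distinct hkp hkq hpq] at hlap hquart
  set P : (Fin 3 → ℝ) → ℝ := fun x =>
    -(x k * (m / 2 * (x q ^ 2 - x p ^ 2) + b * x p + c * x q + d)) with hP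
  have hPs : CkOn 4 Ω P := by
    apply ContDiff.contDiffOn
    rw [hP]; fun_prop
  have hPp : 𝐃 p (𝐃 p P) = fun x => x k * m := by
    rw [hP]
    simp (disch := fun_prop) [partialDeriv_neg, partialDeriv_add, partialDeriv_sub,
      partialDeriv_mul, partialDeriv_sq, partialDeriv_coord, partialDeriv_const, hqp, hkp]
  have hPq : 𝐃 q (𝐃 q P) = fun x => -(x k * m) := by
    rw [hP]
    simp (disch := fun_prop) [partialDeriv_neg, partialDeriv_add, partialDeriv_sub,
      partialDeriv_mul, partialDeriv_sq, partialDeriv_coord, partialDeriv_const, hpq, hkq]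
  obtain ⟨κ, c₁, c₂, c₃, c₄, c₅, c₆, c₇, hG⟩ := exists_eq_harmonicQuartic
    (f := fun x => u x k + P x) hΩ hc hkp hkq hpq ((hu k).add hPs)
    (fun x hx => by
      rw [partialDeriv_add_on hΩ (hu k) hPs k x hx, hα x hx, hP]
      simp (disch := fun_prop) [partialDeriv_neg, partialDeriv_add, partialDeriv_sub,
        partialDeriv_mul, partialDeriv_sq, partialDeriv_coord, partialDeriv_const, hpk, hqk])
    (fun x hx => by
      rw [partialDeriv_add_on_two hΩ (hu k) hPs p p x hx,
        partialDeriv_add_on_two hΩ (hu k) hPs q q x hx, hPp, hPq]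
      linarith [hlap x hx, hk0 x hx])
    (fun x hx => by
      have h0 := partialDeriv_eq_zero hΩ (partialDeriv_eq_zero hΩ hk0 k) k x hx
      rw [partialDeriv_add_on_four hΩ (n := 0) (hu k) hPs p p p p x hx,
        partialDeriv_add_on_four hΩ (n := 0) (hu k) hPs q q q q x hx, hPp, hPq]
      simp (disch := fun_prop) [partialDeriv_neg, partialDeriv_mul, partialDeriv_coord,
        partialDeriv_const, hkp, hkq]
      linarith [hquart x hx])
  refine ⟨m, b, c, d, κ, c₁, c₂, c₃, c₄, c₅, c₆, c₇, fun x hx => ⟨hα x hx, ?_⟩⟩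
  have := hG x hx
  simp only [hP] at this
  linarith

theorem affine_eq_zero (hΩ : IsOpen Ω) (hne : Ω.Nonempty) {m b : ℝ}
    (h : ∀ x ∈ Ω, m * x k + b = 0) : m = 0 ∧ b = 0 := by
  obtain ⟨x, hx⟩ := hne
  have h1 := partialDeriv_eq_zero hΩ h k x hx
  simp (disch := fun_prop) [partialDeriv_add, partialDeriv_mul, partialDeriv_coord,
    partialDeriv_const] at h1
  have h2 := h x hx
  rw [h1] at h2
  exact ⟨h1, by linarith⟩

theorem exists_cubicForm (h : CubicUniversalityPDEs Ω u) (hΩ : IsOpen Ω)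
    (hc : IsPreconnected Ω) (hu : ∀ k, CkOn 4 Ω fun y => u y k) :
    ∃ (a a₁ b₁ c₁ d₁ d₂ d₃ : ℝ) (g₁ g₂ g₃ : ℝ → ℝ → ℝ),
      HasCubicForm Ω u a a₁ b₁ c₁ d₁ d₂ d₃ g₁ g₂ g₃ ∧
      IsHarmonic g₁ ∧ IsHarmonic g₂ ∧ IsHarmonic g₃ ∧
      FourthOrderPDEs g₁ ∧ FourthOrderPDEs g₂ ∧ FourthOrderPDEs g₃ := by
  have hq := fun κ c₁ c₂ c₃ c₄ c₅ c₆ c₇ : ℝ =>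
    (fourthOrderRepresentation_harmonicQuartic κ c₁ c₂ c₃ c₄ c₅ c₆ c₇).fourthOrderPDEs
  have hh := isHarmonic_harmonicQuartic
  -- Comparing coefficients needs a point of Ω.
  rcases Ω.eq_empty_or_nonempty with rfl | hne
  · exact ⟨0, 0, 0, 0, 0, 0, 0, _, _, _, fun x hx => absurd hx (Set.notMem_empty x),
      hh 0 0 0 0 0 0 0 0, hh 0 0 0 0 0 0 0 0, hh 0 0 0 0 0 0 0 0, hq .., hq .., hq ..⟩
  obtain ⟨m0, b0, c0, d0, κ0, p1, p2, p3, p4, p5, p6, p7, h0⟩ :=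
    h.exists_component_eq (k := 0) (p := 1) (q := 2) hΩ hc hu
      (by decide) (by decide) (by decide)
  obtain ⟨m1, b1, c1, d1, κ1, q1, q2, q3, q4, q5, q6, q7, h1⟩ :=
    h.exists_component_eq (k := 1) (p := 0) (q := 2) hΩ hc hu
      (by decide) (by decide) (by decide)
  obtain ⟨m2, b2, c2, d2, κ2, r1, r2, r3, r4, r5, r6, r7, h2⟩ :=
    h.exists_component_eq (k := 2) (p := 0) (q := 1) hΩ hc hu
      (by decide) (by decide) (by decide)
  have e0 := fun i => partialDeriv_congr hΩ (fun x hx => (h0 x hx).1) i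
  have e1 := fun i => partialDeriv_congr hΩ (fun x hx => (h1 x hx).1) i
  have e2 := fun i => partialDeriv_congr hΩ (fun x hx => (h2 x hx).1) i
  have hd := h.div_const
  simp only [Fin.sum_univ_three] at hd
  obtain ⟨hm12, hb12⟩ := affine_eq_zero (k := 0) (m := -(m1 + m2)) (b := b1 + b2) hΩ hne
    fun x hx => by
      have := hd 0 x hx
      rw [e0 0 x hx, e1 0 x hx, e2 0 x hx] at this
      simp (disch := fun_prop) [partialDeriv_add, partialDeriv_sub, partialDeriv_mul,
        partialDeriv_sq, partialDeriv_coord, partialDeriv_const] at this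
      linarith
  obtain ⟨hm02, hb02⟩ := affine_eq_zero (k := 1) (m := m2 - m0) (b := b0 + c2) hΩ hne
    fun x hx => by
      have := hd 1 x hx
      rw [e0 1 x hx, e1 1 x hx, e2 1 x hx] at this
      simp (disch := fun_prop) [partialDeriv_add, partialDeriv_sub, partialDeriv_mul,
        partialDeriv_sq, partialDeriv_coord, partialDeriv_const] at this
      linarith
  -- The slope relation m0 + m1 = 0 already follows from the previous two, which give (m0, m1, m2) =
  -- (a, -a, a).
  obtain ⟨-, hc01⟩ := affine_eq_zero (k := 2) (m := m0 + m1) (b := c0 + c1) hΩ hne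
    fun x hx => by
      have := hd 2 x hx
      rw [e0 2 x hx, e1 2 x hx, e2 2 x hx] at this
      simp (disch := fun_prop) [partialDeriv_add, partialDeriv_sub, partialDeriv_mul,
        partialDeriv_sq, partialDeriv_coord, partialDeriv_const] at this
      linarith
  refine ⟨m0, b1, b0, c0, d0, d1, d2, harmonicQuartic κ0 p1 p2 p3 p4 p5 p6 p7,
    harmonicQuartic κ1 q1 q2 q3 q4 q5 q6 q7, harmonicQuartic κ2 r1 r2 r3 r4 r5 r6 r7,
    fun x hx => ⟨?_, ?_, ?_⟩, hh .., hh .., hh .., hq .., hq .., hq ..⟩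
  · rw [(h0 x hx).2]; ring
  · rw [(h1 x hx).2, show m1 = -m0 by linarith, show c1 = -c0 by linarith]; ring
  · rw [(h2 x hx).2, show m2 = m0 by linarith, show b2 = -b1 by linarith,
      show c2 = -b0 by linarith]; ring

end CubicUniversalityPDEs

/-! ### The cubic form satisfies the system -/

section OfCubicForm

variable {Ω : Set (Fin 3 → ℝ)} {k p q : Fin 3} {g : ℝ → ℝ → ℝ}

/-- The derivatives of a component of a cubic-form displacement. -/
theorem component_derivatives (hΩ : IsOpen Ω) {f : (Fin 3 → ℝ) → ℝ}
    (hkp : k ≠ p) (hkq : k ≠ q) (hpq : p ≠ q) {m b c d : ℝ}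
    (hf : ∀ x ∈ Ω, f x = x k * (m / 2 * (x q ^ 2 - x p ^ 2) + b * x p + c * x q + d) +
      g (x p) (x q))
    (hg : IsHarmonic g) (h4 : FourthOrderPDEs g) :
    (∀ x ∈ Ω, 𝐃 k f x = m / 2 * (x q ^ 2 - x p ^ 2) + b * x p + c * x q + d) ∧
    (∀ x ∈ Ω, ∑ i, 𝐃 i (𝐃 i f) x = 0) ∧
    (∀ x ∈ Ω, ∑ i, 𝐃 i (𝐃 i (𝐃 i (𝐃 i f))) x = 0) := by
  have hpk := hkp.symm
  have hqk := hkq.symm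
  have hqp := hpq.symm
  set P : (Fin 3 → ℝ) → ℝ := fun x =>
    x k * (m / 2 * (x q ^ 2 - x p ^ 2) + b * x p + c * x q + d) with hP
  have hPs : CkOn 4 Ω P := by
    apply ContDiff.contDiffOn
    rw [hP]; fun_prop
  have hgs : CkOn 4 Ω fun x => g (x p) (x q) := (contDiff_plane hg.1 p q).contDiffOn
  have hPk : 𝐃 k P = fun x => m / 2 * (x q ^ 2 - x p ^ 2) + b * x p + c * x q + d := by
    rw [hP]
    simp (disch := fun_prop) [partialDeriv_add, partialDeriv_sub,
      partialDeriv_mul, partialDeriv_sq, partialDeriv_coord, partialDeriv_const, hpk, hqk]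
  have hPkk : 𝐃 k (𝐃 k P) = fun x => 0 := by
    rw [hPk]
    simp (disch := fun_prop) [partialDeriv_add, partialDeriv_sub,
      partialDeriv_mul, partialDeriv_sq, partialDeriv_coord, partialDeriv_const, hpk, hqk]
  have hPp : 𝐃 p (𝐃 p P) = fun x => -(x k * m) := by
    rw [hP]
    simp (disch := fun_prop) [partialDeriv_neg, partialDeriv_add, partialDeriv_sub,
      partialDeriv_mul, partialDeriv_sq, partialDeriv_coord, partialDeriv_const, hqp, hkp]
  have hPq : 𝐃 q (𝐃 q P) = fun x => x k * m := by
    rw [hP]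
    simp (disch := fun_prop) [partialDeriv_add, partialDeriv_sub,
      partialDeriv_mul, partialDeriv_sq, partialDeriv_coord, partialDeriv_const, hpq, hkq]
  have hgk : ∀ x ∈ Ω, 𝐃 k (fun x => g (x p) (x q)) x = 0 := fun x _ =>
    partialDeriv_plane_eq_zero hg.1 hkp hkq x
  have hgkk := partialDeriv_eq_zero hΩ hgk k
  have D2 := fun i => partialDeriv_congr hΩ (partialDeriv_congr hΩ hf i) i
  have D4 := fun i => partialDeriv_congr hΩ (partialDeriv_congr hΩ (D2 i) i) i
  refine ⟨fun x hx => ?_, fun x hx => ?_, fun x hx => ?_⟩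
  · rw [partialDeriv_congr hΩ hf k x hx, partialDeriv_add_on hΩ hPs hgs k x hx, hPk,
      hgk x hx, add_zero]
  · rw [sum_eq_of_distinct hkp hkq hpq, D2 k x hx, D2 p x hx, D2 q x hx,
      partialDeriv_add_on_two hΩ hPs hgs k k x hx, partialDeriv_add_on_two hΩ hPs hgs p p x hx,
      partialDeriv_add_on_two hΩ hPs hgs q q x hx, hPkk, hPp, hPq, hgkk x hx]
    linarith [laplacian_plane_eq_zero hg hpq x]
  · have := partialDeriv_eq_zero hΩ (partialDeriv_eq_zero hΩ hgkk k) k x hx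
    rw [sum_eq_of_distinct hkp hkq hpq, D4 k x hx, D4 p x hx, D4 q x hx,
      partialDeriv_add_on_four hΩ (n := 0) hPs hgs k k k k x hx,
      partialDeriv_add_on_four hΩ (n := 0) hPs hgs p p p p x hx,
      partialDeriv_add_on_four hΩ (n := 0) hPs hgs q q q q x hx, hPkk, hPp, hPq, this]
    simp (disch := fun_prop) [partialDeriv_neg, partialDeriv_mul, partialDeriv_coord,
      partialDeriv_const, hkp, hkq]
    linarith [quartic_plane_eq_zero hg.1 h4 hpq x]

/-- The coefficients are arranged so that all nonconstant terms of the three normal strains cancel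
in their sum, leaving div u = d₁ + d₂ + d₃. -/
theorem HasCubicForm.cubicUniversalityPDEs (hΩ : IsOpen Ω) {u : (Fin 3 → ℝ) → Fin 3 → ℝ}
    {a a₁ b₁ c₁ d₁ d₂ d₃ : ℝ} {g₁ g₂ g₃ : ℝ → ℝ → ℝ}
    (h : HasCubicForm Ω u a a₁ b₁ c₁ d₁ d₂ d₃ g₁ g₂ g₃)
    (hg₁ : IsHarmonic g₁) (hg₂ : IsHarmonic g₂) (hg₃ : IsHarmonic g₃)
    (h₁ : FourthOrderPDEs g₁) (h₂ : FourthOrderPDEs g₂) (h₃ : FourthOrderPDEs g₃) :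
    CubicUniversalityPDEs Ω u := by
  obtain ⟨n0, l0, f0⟩ := component_derivatives (f := fun y => u y 0) (k := 0) (p := 1) (q := 2)
    (m := a) (b := b₁) (c := c₁) (d := d₁) hΩ (by decide) (by decide) (by decide)
    (fun x hx => by rw [(h x hx).1]; ring) hg₁ h₁
  obtain ⟨n1, l1, f1⟩ := component_derivatives (f := fun y => u y 1) (k := 1) (p := 0) (q := 2)
    (m := -a) (b := a₁) (c := -c₁) (d := d₂) hΩ (by decide) (by decide) (by decide)
    (fun x hx => by rw [(h x hx).2.1]; ring) hg₂ h₂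
  obtain ⟨n2, l2, f2⟩ := component_derivatives (f := fun y => u y 2) (k := 2) (p := 0) (q := 1)
    (m := a) (b := -a₁) (c := -b₁) (d := d₃) hΩ (by decide) (by decide) (by decide)
    (fun x hx => by rw [(h x hx).2.2]; ring) hg₃ h₃
  have e0 := fun i => partialDeriv_congr hΩ n0 i
  have e1 := fun i => partialDeriv_congr hΩ n1 i
  have e2 := fun i => partialDeriv_congr hΩ n2 i
  refine ⟨Fin.forall_fin_succ.2 ⟨?_, Fin.forall_fin_two.2 ⟨?_, ?_⟩⟩,
    Fin.forall_fin_succ.2 ⟨l0, Fin.forall_fin_two.2 ⟨l1, l2⟩⟩, fun k x hx => ?_,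
    Fin.forall_fin_succ.2 ⟨f0, Fin.forall_fin_two.2 ⟨f1, f2⟩⟩⟩
  · intro x hx
    rw [e0 0 x hx]
    simp (disch := fun_prop) [partialDeriv_add, partialDeriv_sub, partialDeriv_mul,
      partialDeriv_sq, partialDeriv_coord, partialDeriv_const]
  · intro x hx
    refine (e1 1 x hx).trans ?_
    simp (disch := fun_prop) [partialDeriv_neg, partialDeriv_add, partialDeriv_sub,
      partialDeriv_mul, partialDeriv_sq, partialDeriv_coord, partialDeriv_const]
  · intro x hx
    refine (e2 2 x hx).trans ?_
    simp (disch := fun_prop) [partialDeriv_neg, partialDeriv_add, partialDeriv_sub,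
      partialDeriv_mul, partialDeriv_sq, partialDeriv_coord, partialDeriv_const]
  · rw [Fin.sum_univ_three, e0 k x hx, e1 k x hx, e2 k x hx]
    fin_cases k <;>
    simp (disch := fun_prop) [partialDeriv_neg, partialDeriv_add, partialDeriv_sub,
      partialDeriv_mul, partialDeriv_sq, partialDeriv_coord, partialDeriv_const] <;> ring

end OfCubicForm

/-! ### Equilibrium equations in terms of displacements -/

section Calculus

variable {Ω : Set (Fin 3 → ℝ)} {f : (Fin 3 → ℝ) → ℝ} {n : ℕ}

theorem partialDeriv_linearCombination (hΩ : IsOpen Ω) {F : Fin 3 → Fin 3 → Fin 3 → (Fin 3 → ℝ) → ℝ}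
    (hF : ∀ l m n', CkOn (n + 1) Ω (F l m n')) (c : Fin 3 → Fin 3 → Fin 3 → ℝ) (i : Fin 3) :
    ∀ x ∈ Ω, 𝐃 i (fun y => ∑ l, ∑ m, ∑ n', c l m n' * F l m n' y) x =
      ∑ l, ∑ m, ∑ n', c l m n' * 𝐃 i (F l m n') x := by
  intro x hx
  have h0 : ∀ l m n', DifferentiableAt ℝ (F l m n') x := fun l m n' =>
    (hF l m n').differentiableAt hΩ hx
  rw [partialDeriv_sum_apply (fun l _ => by fun_prop)]
  refine Finset.sum_congr rfl fun l _ => ?_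
  rw [partialDeriv_sum_apply (fun m _ => by fun_prop)]
  refine Finset.sum_congr rfl fun m _ => ?_
  rw [partialDeriv_sum_apply (fun n' _ => by fun_prop)]
  exact Finset.sum_congr rfl fun n' _ => partialDeriv_const_mul_apply (h0 l m n') _ _

theorem partialDeriv_comm₂ (hΩ : IsOpen Ω) (hf : CkOn (n + 4) Ω f) (i j l m : Fin 3) :
    ∀ x ∈ Ω, 𝐃 i (𝐃 j (𝐃 l (𝐃 m f))) x = 𝐃 j (𝐃 i (𝐃 l (𝐃 m f))) x :=
  partialDeriv_comm hΩ ((hf.partialDeriv hΩ m).partialDeriv hΩ l) i j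

theorem partialDeriv_comm₃ (hΩ : IsOpen Ω) (hf : CkOn (n + 4) Ω f) (i j l m : Fin 3) :
    ∀ x ∈ Ω, 𝐃 i (𝐃 j (𝐃 l (𝐃 m f))) x = 𝐃 i (𝐃 l (𝐃 j (𝐃 m f))) x :=
  partialDeriv_congr hΩ (partialDeriv_comm hΩ (hf.partialDeriv hΩ m) j l) i

theorem partialDeriv_comm₄ (hΩ : IsOpen Ω) (hf : CkOn (n + 4) Ω f) (i j l m : Fin 3) :
    ∀ x ∈ Ω, 𝐃 i (𝐃 j (𝐃 l (𝐃 m f))) x = 𝐃 i (𝐃 j (𝐃 m (𝐃 l f))) x :=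
  partialDeriv_congr hΩ (partialDeriv_congr hΩ (partialDeriv_comm hΩ hf l m) j) i

end Calculus

namespace Material

variable (𝓜 : Material) {Ω : Set (Fin 3 → ℝ)} {u : (Fin 3 → ℝ) → Fin 3 → ℝ}

theorem C_right (i j l m : Fin 3) : 𝓜.C i j l m = 𝓜.C i j m l := by
  rw [𝓜.C_major, 𝓜.C_minor, 𝓜.C_major]

theorem A_right (i j k l m n : Fin 3) : 𝓜.A i j k l m n = 𝓜.A i j k m l n := by
  rw [𝓜.A_major, 𝓜.A_minor, 𝓜.A_major]

/-- Symmetry of C in its last two indices lets the displacement gradient replace the strain. -/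
theorem cauchyStress_eq (hM : ∀ i j k l m, 𝓜.M i j k l m = 0) (u : (Fin 3 → ℝ) → Fin 3 → ℝ)
    (i k : Fin 3) :
    𝓜.cauchyStress u i k = fun x => ∑ l, ∑ m, 𝓜.C i k l m * 𝐃 m (fun y => u y l) x := by
  funext x
  have hswap : ∑ l, ∑ m, 𝓜.C i k l m * 𝐃 l (fun y => u y m) x =
      ∑ l, ∑ m, 𝓜.C i k l m * 𝐃 m (fun y => u y l) x := by
    rw [Finset.sum_comm]
    exact Finset.sum_congr rfl fun l _ => Finset.sum_congr rfl fun m _ => by rw [𝓜.C_right]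
  have hsplit : ∑ l, ∑ m, 𝓜.C i k l m * strain u l m x =
      (1 / 2) * ∑ l, ∑ m, 𝓜.C i k l m * 𝐃 m (fun y => u y l) x +
        (1 / 2) * ∑ l, ∑ m, 𝓜.C i k l m * 𝐃 l (fun y => u y m) x := by
    simp only [Finset.mul_sum, ← Finset.sum_add_distrib]
    exact Finset.sum_congr rfl fun l _ => Finset.sum_congr rfl fun m _ => by
      rw [strain]; ring
  simp only [cauchyStress, hM, zero_mul, Finset.sum_const_zero, add_zero]
  rw [hsplit, hswap]
  ring

theorem hyperStress_eq (hM : ∀ i j k l m, 𝓜.M i j k l m = 0) (hΩ : IsOpen Ω)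
    (hu : ∀ k, CkOn 4 Ω fun y => u y k) (i j k : Fin 3) :
    ∀ x ∈ Ω, 𝓜.hyperStress u i j k x =
      ∑ l, ∑ m, ∑ n, 𝓜.A i j k l m n * 𝐃 n (𝐃 m fun y => u y l) x := by
  intro x hx
  have hd : ∀ l m, DifferentiableAt ℝ (𝐃 m fun y => u y l) x := fun l m =>
    ((hu l).partialDeriv hΩ m).differentiableAt hΩ hx
  have hstrain : ∀ l m n, 𝐃 n (strain u l m) x =
      (1 / 2) * (𝐃 n (𝐃 m fun y => u y l) x + 𝐃 n (𝐃 l fun y => u y m) x) := by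
    intro l m n
    unfold strain
    rw [partialDeriv_const_mul_apply ((hd l m).fun_add (hd m l)),
      partialDeriv_add_apply (hd l m) (hd m l)]
  have hswap : ∑ l, ∑ m, ∑ n, 𝓜.A i j k l m n * 𝐃 n (𝐃 l fun y => u y m) x =
      ∑ l, ∑ m, ∑ n, 𝓜.A i j k l m n * 𝐃 n (𝐃 m fun y => u y l) x := by
    rw [Finset.sum_comm]
    exact Finset.sum_congr rfl fun l _ => Finset.sum_congr rfl fun m _ =>
      Finset.sum_congr rfl fun n _ => by rw [𝓜.A_right]
  have hsplit : ∑ l, ∑ m, ∑ n, 𝓜.A i j k l m n * 𝐃 n (strain u l m) x =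
      (1 / 2) * ∑ l, ∑ m, ∑ n, 𝓜.A i j k l m n * 𝐃 n (𝐃 m fun y => u y l) x +
        (1 / 2) * ∑ l, ∑ m, ∑ n, 𝓜.A i j k l m n * 𝐃 n (𝐃 l fun y => u y m) x := by
    simp only [Finset.mul_sum, ← Finset.sum_add_distrib]
    exact Finset.sum_congr rfl fun l _ => Finset.sum_congr rfl fun m _ =>
      Finset.sum_congr rfl fun n _ => by rw [hstrain]; ring
  simp only [hyperStress, hM, zero_mul, Finset.sum_const_zero, zero_add]
  rw [hsplit, hswap]
  ring

/-- The equilibrium equations of a centrosymmetric material in terms of displacements. -/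
theorem inEquilibrium_iff (hM : ∀ i j k l m, 𝓜.M i j k l m = 0) (hΩ : IsOpen Ω)
    (hu : ∀ k, CkOn 4 Ω fun y => u y k) :
    𝓜.InEquilibrium Ω u ↔ ∀ x ∈ Ω, ∀ k,
      (∑ i, ∑ l, ∑ m, 𝓜.C i k l m * 𝐃 i (𝐃 m fun y => u y l) x) -
        ∑ i, ∑ j, ∑ l, ∑ m, ∑ n,
          𝓜.A i j k l m n * 𝐃 j (𝐃 i (𝐃 n (𝐃 m fun y => u y l))) x = 0 := by
  refine forall₃_congr fun x hx k => ?_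
  have h1 : ∀ i, 𝐃 i (𝓜.cauchyStress u i k) x =
      ∑ l, ∑ m, 𝓜.C i k l m * 𝐃 i (𝐃 m fun y => u y l) x := by
    intro i
    have hd : ∀ l m, DifferentiableAt ℝ (𝐃 m fun y => u y l) x := fun l m =>
      ((hu l).partialDeriv hΩ m).differentiableAt hΩ hx
    rw [cauchyStress_eq 𝓜 hM, partialDeriv_sum_apply (fun l _ => by fun_prop)]
    refine Finset.sum_congr rfl fun l _ => ?_
    rw [partialDeriv_sum_apply (fun m _ => by fun_prop)]
    exact Finset.sum_congr rfl fun m _ => partialDeriv_const_mul_apply (hd l m) _ _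
  have hu2 : ∀ l m n, CkOn 2 Ω (𝐃 n (𝐃 m fun y => u y l)) := fun l m n =>
    ((hu l).partialDeriv hΩ m).partialDeriv hΩ n
  have h2 : ∀ i j, 𝐃 j (𝐃 i (𝓜.hyperStress u i j k)) x = ∑ l, ∑ m, ∑ n,
      𝓜.A i j k l m n * 𝐃 j (𝐃 i (𝐃 n (𝐃 m fun y => u y l))) x := by
    intro i j
    rw [partialDeriv_congr hΩ (partialDeriv_congr hΩ (𝓜.hyperStress_eq hM hΩ hu i j k) i) j x hx,
      partialDeriv_congr hΩ (partialDeriv_linearCombination hΩ hu2 _ i) j x hx,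
      partialDeriv_linearCombination hΩ (fun l m n => (hu2 l m n).partialDeriv hΩ i) _ j x hx]
  simp only [h1, h2]

end Material

/-! ### The cubic group as signed permutation matrices -/

/-- `Q` is the matrix of the signed permutation `(σ, ε)`. -/
def IsSignedPerm (Q : Matrix (Fin 3) (Fin 3) ℝ) (σ : Equiv.Perm (Fin 3)) (ε : Fin 3 → ℝ) : Prop :=
  (∀ i, ε i ^ 2 = 1) ∧ ∀ i j, Q i j = if j = σ i then ε i else 0

namespace IsSignedPerm

variable {Q : Matrix (Fin 3) (Fin 3) ℝ} {σ : Equiv.Perm (Fin 3)} {ε : Fin 3 → ℝ}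

theorem sum_row (h : IsSignedPerm Q σ ε) (i : Fin 3) (F : Fin 3 → ℝ) :
    ∑ o, Q i o * F o = ε i * F (σ i) := by
  simp [h.2]

theorem neg (h : IsSignedPerm Q σ ε) : IsSignedPerm (-Q) σ (fun i => -ε i) :=
  ⟨fun i => by rw [neg_sq, h.1], fun i j => by simp only [Matrix.neg_apply, h.2]; split_ifs <;> simp⟩

theorem eq_one_or (h : IsSignedPerm Q σ ε) (i : Fin 3) : ε i = 1 ∨ ε i = -1 :=
  sq_eq_one_iff.1 (h.1 i)

theorem mulVec_single (h : IsSignedPerm Q σ ε) (j : Fin 3) :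
    Q.mulVec (Pi.single j 1) = ε (σ.symm j) • Pi.single (σ.symm j) 1 := by
  funext i
  rw [Matrix.mulVec_single_one, Matrix.col_apply, h.2]
  by_cases hi : i = σ.symm j
  · subst hi; simp
  · have : ¬ j = σ i := fun hj => hi (by rw [hj]; simp)
    simp [this, hi]

theorem image_octahedronVertices (h : IsSignedPerm Q σ ε) :
    (fun v => Q.mulVec v) '' octahedronVertices = octahedronVertices := by
  have hmem : ∀ (i : Fin 3) (c : ℝ), c = 1 ∨ c = -1 →
      c • (Pi.single i 1 : Fin 3 → ℝ) ∈ octahedronVertices := by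
    rintro i c (rfl | rfl)
    · exact ⟨i, Or.inl (one_smul _ _)⟩
    · exact ⟨i, Or.inr (by simp)⟩
  have hneg : ∀ v ∈ octahedronVertices, -v ∈ octahedronVertices := by
    rintro v ⟨i, rfl | rfl⟩
    · exact ⟨i, Or.inr rfl⟩
    · exact ⟨i, Or.inl (neg_neg _)⟩
  have hsurj : ∀ i : Fin 3, ∃ v ∈ octahedronVertices, Q.mulVec v = Pi.single i 1 := by
    intro i
    refine ⟨ε i • Pi.single (σ i) 1, hmem _ _ (h.eq_one_or i), ?_⟩
    rw [Matrix.mulVec_smul, h.mulVec_single, smul_smul]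
    simp [← pow_two, h.1]
  apply Set.Subset.antisymm
  · rintro _ ⟨v, ⟨j, rfl | rfl⟩, rfl⟩
    · simp only [h.mulVec_single]
      exact hmem _ _ (h.eq_one_or _)
    · simp only [Matrix.mulVec_neg, h.mulVec_single]
      exact hneg _ (hmem _ _ (h.eq_one_or _))
  · rintro _ ⟨i, rfl | rfl⟩
    · obtain ⟨v, hv, e⟩ := hsurj i
      exact ⟨v, hv, e⟩
    · obtain ⟨v, hv, e⟩ := hsurj i
      exact ⟨-v, hneg v hv, by simp only [Matrix.mulVec_neg, e]⟩

theorem mem_fullOctahedralGroup {Q : Matrix.orthogonalGroup (Fin 3) ℝ}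
    (h : IsSignedPerm Q.1 σ ε) : Q ∈ fullOctahedralGroup := by
  have hdet : Q.1.det ^ 2 = 1 := by
    have h1 := congrArg Matrix.det ((Matrix.mem_orthogonalGroup_iff _ _).1 Q.2)
    rw [Matrix.det_mul, Matrix.det_transpose, Matrix.det_one] at h1
    rw [sq, h1]
  rcases sq_eq_one_iff.1 hdet with h1 | h1
  · exact Or.inl ⟨h1, h.image_octahedronVertices⟩
  · refine Or.inr ⟨?_, h.neg.image_octahedronVertices⟩
    change (-Q.1).det = 1
    rw [Matrix.det_neg, h1]
    norm_num

end IsSignedPerm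

/-- The orthogonal matrix of a signed permutation. -/
theorem exists_orthogonal_isSignedPerm (σ : Equiv.Perm (Fin 3)) {ε : Fin 3 → ℝ}
    (hε : ∀ i, ε i ^ 2 = 1) :
    ∃ Q : Matrix.orthogonalGroup (Fin 3) ℝ, IsSignedPerm Q.1 σ ε := by
  refine ⟨⟨Matrix.of fun i j => if j = σ i then ε i else 0, ?_⟩, hε, fun i j => rfl⟩
  rw [Matrix.mem_orthogonalGroup_iff]
  ext i j
  simp only [Matrix.mul_apply, Matrix.of_apply, Matrix.transpose_apply, Matrix.one_apply]
  by_cases hij : i = j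
  · subst hij; simp [← sq, hε]
  · have : ¬ j = i := fun h => hij h.symm
    simp [hij, this]

/-- A unit row with entries 0, ±1 has exactly one nonzero entry, and orthogonality of distinct rows
puts these entries in distinct columns. -/
theorem exists_isSignedPerm_of_entries (Q : Matrix.orthogonalGroup (Fin 3) ℝ)
    (h : ∀ i j, Q.1 i j = 0 ∨ Q.1 i j ^ 2 = 1) : ∃ σ ε, IsSignedPerm Q.1 σ ε := by
  have horth : ∀ i j, ∑ l, Q.1 i l * Q.1 j l = if i = j then 1 else 0 := by
    intro i j
    have := congrFun (congrFun ((Matrix.mem_orthogonalGroup_iff _ _).1 Q.2) i) j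
    simpa [Matrix.mul_apply, Matrix.one_apply] using this
  have hex : ∀ i, ∃ j, Q.1 i j ^ 2 = 1 := by
    intro i
    by_contra! hcon
    have h0 : ∀ j, Q.1 i j = 0 := fun j => (h i j).resolve_right (hcon j)
    have := horth i i
    simp [h0] at this
  choose f hf using hex
  have hzero : ∀ i j, j ≠ f i → Q.1 i j = 0 := by
    intro i j hj
    have h1 := horth i i
    rw [if_pos rfl, ← Finset.add_sum_erase _ _ (Finset.mem_univ (f i)), ← sq, hf i] at h1
    have h2 : ∑ l ∈ Finset.univ.erase (f i), Q.1 i l * Q.1 i l = 0 := by linarith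
    have h3 := (Finset.sum_eq_zero_iff_of_nonneg (fun l _ => mul_self_nonneg _)).1 h2 j (by simp [hj])
    exact mul_self_eq_zero.1 h3
  have hinj : Function.Injective f := by
    intro i j hij
    by_contra hne
    have h1 := horth i j
    rw [if_neg hne, Finset.sum_eq_single (f i) (fun l _ hl => by rw [hzero i l hl, zero_mul])
      (by simp)] at h1
    rcases mul_eq_zero.1 h1 with h2 | h2
    · have := hf i; rw [h2] at this; norm_num at this
    · have := hf j; rw [← hij, h2] at this; norm_num at this
  refine ⟨Equiv.ofBijective f (Finite.injective_iff_bijective.1 hinj), fun i => Q.1 i (f i), hf,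
    fun i j => ?_⟩
  rw [Equiv.ofBijective_apply]
  split_ifs with hj
  · rw [hj]
  · exact hzero i j hj

theorem exists_isSignedPerm_of_mem {Q : Matrix.orthogonalGroup (Fin 3) ℝ}
    (hQ : Q ∈ fullOctahedralGroup) : ∃ σ ε, IsSignedPerm Q.1 σ ε := by
  have key : ∀ R : Matrix (Fin 3) (Fin 3) ℝ,
      (fun v => R.mulVec v) '' octahedronVertices = octahedronVertices →
      ∀ i j, R i j = 0 ∨ R i j ^ 2 = 1 := by
    intro R hR i j
    have hmem : R.mulVec (Pi.single j 1) ∈ octahedronVertices := by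
      rw [← hR]
      exact ⟨_, ⟨j, Or.inl rfl⟩, rfl⟩
    rw [Matrix.mulVec_single_one] at hmem
    obtain ⟨l, hl | hl⟩ := hmem
    · have := congrFun hl i
      rw [Matrix.col_apply] at this
      rw [this, Pi.single_apply]
      split_ifs <;> simp
    · have := congrFun hl i
      rw [Matrix.col_apply] at this
      rw [this, Pi.neg_apply, Pi.single_apply]
      split_ifs <;> simp
  apply exists_isSignedPerm_of_entries
  rcases hQ with hQ | hQ
  · exact key _ hQ.2
  · intro i j
    have := key _ hQ.2 i j
    change (-Q.1) i j = 0 ∨ (-Q.1) i j ^ 2 = 1 at this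
    simpa using this

namespace Material

variable {𝓜 : Material} {σ : Equiv.Perm (Fin 3)} {ε : Fin 3 → ℝ}
  {Q : Matrix.orthogonalGroup (Fin 3) ℝ}

theorem mem_symmC_iff (h : IsSignedPerm Q.1 σ ε) :
    Q ∈ 𝓜.symmC ↔ ∀ i j k l, ε i * (ε j * (ε k * (ε l * 𝓜.C (σ i) (σ j) (σ k) (σ l)))) =
      𝓜.C i j k l := by
  simp only [symmC, Set.mem_ofPred_eq, mul_assoc, ← Finset.mul_sum, h.sum_row]

theorem mem_symmM_iff (h : IsSignedPerm Q.1 σ ε) :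
    Q ∈ 𝓜.symmM ↔ ∀ i j k l m,
      ε i * (ε j * (ε k * (ε l * (ε m * 𝓜.M (σ i) (σ j) (σ k) (σ l) (σ m))))) =
        𝓜.M i j k l m := by
  simp only [symmM, Set.mem_ofPred_eq, mul_assoc, ← Finset.mul_sum, h.sum_row]

theorem mem_symmA_iff (h : IsSignedPerm Q.1 σ ε) :
    Q ∈ 𝓜.symmA ↔ ∀ i j k l m n,
      ε i * (ε j * (ε k * (ε l * (ε m * (ε n * 𝓜.A (σ i) (σ j) (σ k) (σ l) (σ m) (σ n)))))) =
        𝓜.A i j k l m n := by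
  simp only [symmA, Set.mem_ofPred_eq, mul_assoc, ← Finset.mul_sum, h.sum_row]

end Material

/-! ### Parity of indices and vanishing fourth derivatives -/

/-- The sign of the index `i` under the reflection `x_a ↦ -x_a`. -/
def reflSign (a i : Fin 3) : ℤ := if i = a then -1 else 1

theorem reflSign_sq (a i : Fin 3) : ((reflSign a i : ℤ) : ℝ) ^ 2 = 1 := by
  unfold reflSign; split_ifs <;> norm_num

/-- Each axis occurs an even number of times among four indices. Integer signs make this decidable.
-/
theorem paired_of_reflSign (i j k l : Fin 3)
    (h : ∀ a, reflSign a i * reflSign a j * reflSign a k * reflSign a l = 1) :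
    (i = j ∧ k = l) ∨ (i = k ∧ j = l) ∨ (i = l ∧ j = k) := by
  revert i j k l; decide

namespace CubicUniversalityPDEs

variable {Ω : Set (Fin 3 → ℝ)} {u : (Fin 3 → ℝ) → Fin 3 → ℝ} {k p q : Fin 3}

theorem exists_distinct (k : Fin 3) : ∃ p q, k ≠ p ∧ k ≠ q ∧ p ≠ q := by
  revert k; decide

theorem exists_ne_ne (i j : Fin 3) : ∃ q, i ≠ q ∧ j ≠ q := by
  revert i j; decide

/-- An index `k` brings in ∂_k²u_k, two distinct other indices bring in the mixed equation, and a
triple ppp becomes -pqq by harmonicity. The argument is local, so connectedness of Ω plays no role.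
-/
theorem third_normal_eq_zero (h : CubicUniversalityPDEs Ω u) (hΩ : IsOpen Ω)
    (hu : ∀ k, CkOn 4 Ω fun y => u y k) (k i j l : Fin 3) :
    ∀ x ∈ Ω, 𝐃 i (𝐃 j (𝐃 l (𝐃 k fun y => u y k))) x = 0 := by
  have h12 := partialDeriv_comm₂ (n := 0) hΩ (hu k)
  have h23 := partialDeriv_comm₃ (n := 0) hΩ (hu k)
  have hk : ∀ i j, ∀ x ∈ Ω, 𝐃 i (𝐃 j (𝐃 k (𝐃 k fun y => u y k))) x = 0 := fun i j =>
    partialDeriv_eq_zero hΩ (partialDeriv_eq_zero hΩ (h.pure k) j) i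
  have hmix : ∀ p q, k ≠ p → k ≠ q → p ≠ q → ∀ i, ∀ x ∈ Ω,
      𝐃 i (𝐃 q (𝐃 p (𝐃 k fun y => u y k))) x = 0 := fun p q hkp hkq hpq i =>
    partialDeriv_eq_zero hΩ (h.mixed hΩ hu hkp hkq hpq) i
  have hcube : ∀ p q, k ≠ p → k ≠ q → p ≠ q → ∀ x ∈ Ω,
      𝐃 p (𝐃 p (𝐃 p (𝐃 k fun y => u y k))) x = 0 := by
    intro p q hkp hkq hpq x hx
    have hneg : ∀ x ∈ Ω, 𝐃 p (𝐃 p (𝐃 k fun y => u y k)) x =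
        -𝐃 q (𝐃 q (𝐃 k fun y => u y k)) x := fun x hx => by
      linarith [h.harmonic_normal hΩ hu hkp hkq hpq x hx]
    rw [partialDeriv_eq_neg hΩ hneg p x hx, h12 _ _ _ _ x hx, hmix q p hkq hkp hpq.symm q x hx,
      neg_zero]
  intro x hx
  by_cases hl : k = l
  · subst hl; exact hk i j x hx
  by_cases hj : k = j
  · subst hj; rw [h23 _ _ _ _ x hx]; exact hk i l x hx
  by_cases hi : k = i
  · subst hi; rw [h12 _ _ _ _ x hx, h23 _ _ _ _ x hx]; exact hk j l x hx
  by_cases hjl : l = j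
  · subst hjl
    by_cases hil : i = l
    · subst hil
      obtain ⟨q, hq1, hq2⟩ : ∃ q, k ≠ q ∧ i ≠ q := exists_ne_ne k i
      exact hcube i q hi hq1 hq2 x hx
    · rw [h12 _ _ _ _ x hx]
      exact hmix l i hl hi (Ne.symm hil) l x hx
  · exact hmix l j hl hj hjl i x hx

/-- A fourth derivative of `u_l` with respect to indices that occur in pairs vanishes, as does one
with respect to indices one of which is `l`. -/
theorem fourth_eq_zero (h : CubicUniversalityPDEs Ω u) (hΩ : IsOpen Ω)
    (hu : ∀ k, CkOn 4 Ω fun y => u y k) (k a b c d : Fin 3)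
    (habcd : k = a ∨ k = b ∨ k = c ∨ k = d ∨ (a = b ∧ c = d) ∨ (a = c ∧ b = d) ∨
      (a = d ∧ b = c)) :
    ∀ x ∈ Ω, 𝐃 a (𝐃 b (𝐃 c (𝐃 d fun y => u y k))) x = 0 := by
  have h12 := partialDeriv_comm₂ (n := 0) hΩ (hu k)
  have h23 := partialDeriv_comm₃ (n := 0) hΩ (hu k)
  have h34 := partialDeriv_comm₄ (n := 0) hΩ (hu k)
  have h3 := h.third_normal_eq_zero hΩ hu k
  intro x hx
  have hk : k = a ∨ k = b ∨ k = c ∨ k = d →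
      𝐃 a (𝐃 b (𝐃 c (𝐃 d fun y => u y k))) x = 0 := by
    rintro (rfl | rfl | rfl | rfl)
    · rw [h12 _ _ _ _ x hx, h23 _ _ _ _ x hx, h34 _ _ _ _ x hx, h3 _ _ _ x hx]
    · rw [h23 _ _ _ _ x hx, h34 _ _ _ _ x hx, h3 _ _ _ x hx]
    · rw [h34 _ _ _ _ x hx, h3 _ _ _ x hx]
    · rw [h3 _ _ _ x hx]
  have hpair : ∀ p q, k ≠ p → k ≠ q → 𝐃 p (𝐃 p (𝐃 q (𝐃 q fun y => u y k))) x = 0 := by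
    have hsum : ∀ p, ∑ i, 𝐃 p (𝐃 p (𝐃 i (𝐃 i fun y => u y k))) x = 0 := by
      intro p
      have hd := fun i => ((hu k).partialDeriv hΩ i).partialDeriv hΩ i
      have hp : ∀ x ∈ Ω, ∑ i, 𝐃 p (𝐃 i (𝐃 i fun y => u y k)) x = 0 := fun x hx => by
        rw [← partialDeriv_sum_apply (fun i _ => (hd i).differentiableAt hΩ hx)]
        exact partialDeriv_eq_zero hΩ (h.harmonic k) p x hx
      rw [← partialDeriv_sum_apply (fun i _ => ((hd i).partialDeriv hΩ p).differentiableAt hΩ hx)]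
      exact partialDeriv_eq_zero hΩ hp p x hx
    have hquart := h.quartic k x hx
    obtain ⟨p, q, hkp, hkq, hpq⟩ := exists_distinct k
    have hp := hsum p
    have hq := hsum q
    -- With X = u_{k,pppp}, Y = u_{k,ppqq}, Z = u_{k,qqqq} this leaves X + Y = 0, Y + Z = 0 and X +
    -- Z = 0, hence X = Y = Z = 0.
    rw [sum_eq_of_distinct hkp hkq hpq, h3 _ _ _ x hx] at hp hq hquart
    have hpqp : 𝐃 p (𝐃 p (𝐃 q (𝐃 q fun y => u y k))) x =
        𝐃 q (𝐃 q (𝐃 p (𝐃 p fun y => u y k))) x := by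
      rw [h23 _ _ _ _ x hx, h34 _ _ _ _ x hx, h12 _ _ _ _ x hx, h23 _ _ _ _ x hx]
    have hcases : ∀ i : Fin 3, k ≠ i → i = p ∨ i = q := by lia
    intro p' q' hp' hq'
    rcases hcases p' hp' with rfl | rfl <;> rcases hcases q' hq' with rfl | rfl <;> linarith
  by_cases hk' : k = a ∨ k = b ∨ k = c ∨ k = d
  · exact hk hk'
  · push Not at hk'
    obtain ⟨ha, hb, hc, hd⟩ := hk'
    rcases habcd with e | e | e | e | ⟨rfl, rfl⟩ | ⟨rfl, rfl⟩ | ⟨rfl, rfl⟩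
    exacts [absurd e ha, absurd e hb, absurd e hc, absurd e hd, hpair a c ha hc,
      by rw [h23 _ _ _ _ x hx]; exact hpair a b ha hb,
      by rw [h34 _ _ _ _ x hx, h23 _ _ _ _ x hx]; exact hpair a b ha hb]

end CubicUniversalityPDEs

/-- Here `k` numbers the equilibrium equation and `l` the displacement component. If k = l, the two
signs cancel and the derivative indices pair up; otherwise reflecting axis `l` forces `l` to occur
among them. -/
theorem strain_indices_of_reflSign (i j k l m n : Fin 3)
    (h : ∀ a, reflSign a i * reflSign a j * reflSign a k * reflSign a l * reflSign a m *
      reflSign a n = 1) :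
    l = j ∨ l = i ∨ l = n ∨ l = m ∨ (j = i ∧ n = m) ∨ (j = n ∧ i = m) ∨ (j = m ∧ i = n) := by
  by_cases hkl : k = l
  · subst hkl
    have h4 : ∀ a, reflSign a j * reflSign a i * reflSign a n * reflSign a m = 1 := by
      intro a
      have := h a
      have hk : reflSign a k * reflSign a k = 1 := by unfold reflSign; split_ifs <;> norm_num
      linear_combination this - reflSign a j * reflSign a i * reflSign a n * reflSign a m * hk
    have := paired_of_reflSign j i n m h4
    tauto
  · by_contra! hcon
    have := h l
    simp [reflSign, hkl, hcon.1.symm, hcon.2.1.symm, hcon.2.2.1.symm, hcon.2.2.2.1.symm] at this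

/-! ### Tensors invariant under the cubic group -/

namespace Material

variable {𝓜 : Material}

/-- Inversion multiplies a fifth-order tensor by (-1)⁵. -/
theorem M_eq_zero (h : fullOctahedralGroup ⊆ 𝓜.symmetryGroup) (i j k l m : Fin 3) :
    𝓜.M i j k l m = 0 := by
  obtain ⟨Q, hQ⟩ := exists_orthogonal_isSignedPerm 1 (ε := fun _ => -1) (by norm_num)
  have := (mem_symmM_iff hQ).1 (h hQ.mem_fullOctahedralGroup).1.2 i j k l m
  simp only [Equiv.Perm.one_apply] at this
  linarith

theorem C_perm (h : fullOctahedralGroup ⊆ 𝓜.symmetryGroup) (σ : Equiv.Perm (Fin 3))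
    (i j k l : Fin 3) : 𝓜.C (σ i) (σ j) (σ k) (σ l) = 𝓜.C i j k l := by
  obtain ⟨Q, hQ⟩ := exists_orthogonal_isSignedPerm σ (ε := fun _ => 1) (by norm_num)
  simpa using (mem_symmC_iff hQ).1 (h hQ.mem_fullOctahedralGroup).2 i j k l

theorem C_eq_zero (h : fullOctahedralGroup ⊆ 𝓜.symmetryGroup) {i j k l : Fin 3}
    (hijkl : ¬ ((i = j ∧ k = l) ∨ (i = k ∧ j = l) ∨ (i = l ∧ j = k))) : 𝓜.C i j k l = 0 := by
  by_contra hne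
  refine hijkl (paired_of_reflSign i j k l fun a => ?_)
  obtain ⟨Q, hQ⟩ := exists_orthogonal_isSignedPerm 1 (ε := fun i => reflSign a i) (reflSign_sq a)
  have := (mem_symmC_iff hQ).1 (h hQ.mem_fullOctahedralGroup).2 i j k l
  simp only [Equiv.Perm.one_apply] at this
  have h1 : ((reflSign a i * reflSign a j * reflSign a k * reflSign a l : ℤ) : ℝ) = 1 := by
    push_cast
    apply mul_right_cancel₀ hne
    linarith
  exact_mod_cast h1

theorem reflSign_of_A_ne_zero (h : fullOctahedralGroup ⊆ 𝓜.symmetryGroup) {i j k l m n : Fin 3}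
    (hne : 𝓜.A i j k l m n ≠ 0) (a : Fin 3) :
    reflSign a i * reflSign a j * reflSign a k * reflSign a l * reflSign a m *
      reflSign a n = 1 := by
  obtain ⟨Q, hQ⟩ := exists_orthogonal_isSignedPerm 1 (ε := fun i => reflSign a i) (reflSign_sq a)
  have := (mem_symmA_iff hQ).1 (h hQ.mem_fullOctahedralGroup).1.1 i j k l m n
  simp only [Equiv.Perm.one_apply] at this
  have h1 : ((reflSign a i * reflSign a j * reflSign a k * reflSign a l * reflSign a m *
      reflSign a n : ℤ) : ℝ) = 1 := by
    push_cast
    apply mul_right_cancel₀ hne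
    linarith
  exact_mod_cast h1

/-- The contraction of a cubic elasticity tensor with second derivatives of a displacement. -/
theorem C_contraction (h : fullOctahedralGroup ⊆ 𝓜.symmetryGroup) {k p q : Fin 3}
    (hkp : k ≠ p) (hkq : k ≠ q) (hpq : p ≠ q) (H : Fin 3 → Fin 3 → Fin 3 → ℝ) :
    ∑ i, ∑ l, ∑ m, 𝓜.C i k l m * H i m l =
      𝓜.C k k k k * H k k k + 𝓜.C k k p p * (H k p p + H k q q) +
        𝓜.C k p k p * (H p k p + H p p k + H q k q + H q q k) := by
  have hpk := hkp.symm
  have hqk := hkq.symm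
  have hqp := hpq.symm
  have e1 : 𝓜.C k k q q = 𝓜.C k k p p := by
    simpa [Equiv.swap_apply_of_ne_of_ne hkp hkq] using (C_perm h (Equiv.swap p q) k k q q).symm
  have e2 : 𝓜.C k q k q = 𝓜.C k p k p := by
    simpa [Equiv.swap_apply_of_ne_of_ne hkp hkq] using (C_perm h (Equiv.swap p q) k q k q).symm
  have z : ∀ i k l m, ¬ ((i = k ∧ l = m) ∨ (i = l ∧ k = m) ∨ (i = m ∧ k = l)) →
      𝓜.C i k l m = 0 := fun i k l m => C_eq_zero h
  simp only [sum_eq_of_distinct hkp hkq hpq]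
  simp (disch := grind) only [z]
  rw [e1, 𝓜.C_minor p k p k, 𝓜.C_right k p p k, 𝓜.C_minor p k k p, 𝓜.C_minor q k q k,
    𝓜.C_right k q q k, 𝓜.C_minor q k k q, e2]
  ring

end Material

theorem CubicUniversalityPDEs.isUniversal {Ω : Set (Fin 3 → ℝ)} {u : (Fin 3 → ℝ) → Fin 3 → ℝ}
    (h : CubicUniversalityPDEs Ω u) (hΩ : IsOpen Ω) (hu : ∀ k, CkOn 4 Ω fun y => u y k) :
    IsUniversal {𝓜 | fullOctahedralGroup ⊆ 𝓜.symmetryGroup} Ω u := by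
  intro 𝓜 h𝓜
  rw [𝓜.inEquilibrium_iff (Material.M_eq_zero h𝓜) hΩ hu]
  intro x hx k
  have hA : ∑ i, ∑ j, ∑ l, ∑ m, ∑ n,
      𝓜.A i j k l m n * 𝐃 j (𝐃 i (𝐃 n (𝐃 m fun y => u y l))) x = 0 := by
    refine Finset.sum_eq_zero fun i _ => Finset.sum_eq_zero fun j _ =>
      Finset.sum_eq_zero fun l _ => Finset.sum_eq_zero fun m _ => Finset.sum_eq_zero fun n _ => ?_
    by_cases hne : 𝓜.A i j k l m n = 0
    · rw [hne, zero_mul]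
    · rw [h.fourth_eq_zero hΩ hu l j i n m (strain_indices_of_reflSign i j k l m n
        (Material.reflSign_of_A_ne_zero h𝓜 hne)) x hx, mul_zero]
  obtain ⟨p, q, hkp, hkq, hpq⟩ := exists_distinct k
  have hdiv := h.div_const k x hx
  have hlap := h.harmonic k x hx
  have hpure := h.pure k x hx
  rw [sum_eq_of_distinct hkp hkq hpq, hpure] at hdiv hlap
  rw [hA, Material.C_contraction h𝓜 hkp hkq hpq fun i m l => partialDeriv i
    (partialDeriv m fun y => u y l) x, partialDeriv_comm (n := 2) hΩ (hu p) p k x hx,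
    partialDeriv_comm (n := 2) hΩ (hu q) q k x hx, hpure]
  -- After commuting derivatives, the mixed terms multiplied by `𝓜.C k p k p` form ∂_k div u and the
  -- others Δu_k, both up to the vanishing ∂_k²u_k.
  linear_combination 𝓜.C k k p p * hdiv + 𝓜.C k p k p * (hdiv + hlap)

/-! ### Test materials with exactly cubic symmetry -/

/-- The Kronecker delta. -/
noncomputable def kron (i j : Fin 3) : ℝ := if i = j then 1 else 0

/-- The Kronecker delta with four indices. -/
noncomputable def kron₄ (i j k l : Fin 3) : ℝ := if i = j ∧ i = k ∧ i = l then 1 else 0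

theorem kron_comm (i j : Fin 3) : kron i j = kron j i := by
  unfold kron; congr 1; grind

theorem kron₄_swap₁₂ (i j k l : Fin 3) : kron₄ i j k l = kron₄ j i k l := by
  unfold kron₄; congr 1; grind

theorem kron₄_rotate (i j k l : Fin 3) : kron₄ i j k l = kron₄ k l i j := by
  unfold kron₄; congr 1; grind

/-- A four-parameter family of cubic materials. -/
noncomputable def cubicMaterial (s lam μ t : ℝ) : Material where
  C i j l m := s * kron₄ i j l m + lam * (kron i j * kron l m) +
    μ * (kron i l * kron j m + kron i m * kron j l)
  M _ _ _ _ _ := 0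
  -- The four terms are the orbit of δ_in δ_jklm under the minor and major index symmetries. In the
  -- equilibrium equation δ_kl δ_ijmn contributes Σᵢ ∂ᵢ⁴uₖ, while each term from the other three
  -- contains a pure second derivative ∂ᵢ²uᵢ or ∂ₖ²uₖ.
  A i j k l m n := t * (kron i n * kron₄ j k l m + kron j n * kron₄ i k l m +
    kron k l * kron₄ i j m n + kron k m * kron₄ i j l n)
  C_minor i j l m := by rw [kron₄_swap₁₂, kron_comm i j]; ring
  C_major i j l m := by
    rw [kron₄_rotate, kron_comm i l, kron_comm j m, kron_comm i m, kron_comm j l]; ring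
  M_left _ _ _ _ _ := rfl
  M_right _ _ _ _ _ := rfl
  A_minor i j k l m n := by
    rw [kron₄_swap₁₂ i j m n, kron₄_swap₁₂ i j l n]; ring
  A_major i j k l m n := by
    rw [kron_comm k l, kron_comm k m, kron_comm i n, kron_comm j n,
      kron₄_rotate i j m n, kron₄_rotate i j l n, kron₄_rotate j k l m, kron₄_rotate i k l m]
    ring

section Invariance

variable {σ : Equiv.Perm (Fin 3)} {ε : Fin 3 → ℝ}

theorem kron_invariant (hε : ∀ i, ε i ^ 2 = 1) (i j : Fin 3) :
    ε i * ε j * kron (σ i) (σ j) = kron i j := by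
  unfold kron
  simp only [σ.injective.eq_iff]
  split_ifs with h
  · rw [← h, ← sq, hε, one_mul]
  · rw [mul_zero]

theorem kron₄_invariant (hε : ∀ i, ε i ^ 2 = 1) (i j k l : Fin 3) :
    ε i * ε j * ε k * ε l * kron₄ (σ i) (σ j) (σ k) (σ l) = kron₄ i j k l := by
  unfold kron₄
  simp only [σ.injective.eq_iff]
  split_ifs with h
  · obtain ⟨rfl, rfl, rfl⟩ := h
    linear_combination (ε i ^ 2 + 1) * hε i
  · rw [mul_zero]

end Invariance

theorem fullOctahedralGroup_subset_symmetryGroup (s lam μ t : ℝ) :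
    fullOctahedralGroup ⊆ (cubicMaterial s lam μ t).symmetryGroup := by
  intro Q hQ
  obtain ⟨σ, ε, h⟩ := exists_isSignedPerm_of_mem hQ
  have h2 := kron_invariant (σ := σ) h.1
  have h4 := kron₄_invariant (σ := σ) h.1
  refine ⟨⟨(Material.mem_symmA_iff h).2 fun i j k l m n => ?_,
    (Material.mem_symmM_iff h).2 fun i j k l m => by simp [cubicMaterial]⟩,
    (Material.mem_symmC_iff h).2 fun i j l m => ?_⟩
  · simp only [cubicMaterial]
    rw [← h2 i n, ← h2 j n, ← h2 k l, ← h2 k m, ← h4 j k l m, ← h4 i k l m, ← h4 i j m n,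
      ← h4 i j l n]
    ring
  · simp only [cubicMaterial]
    rw [← h2 i j, ← h2 l m, ← h2 i l, ← h2 j m, ← h2 i m, ← h2 j l, ← h4 i j l m]
    ring

/-- The tensor C alone excludes further symmetries. The isotropic part of C_iiii is automatically
invariant, so s ≠ 0 forces Σⱼ Qᵢⱼ⁴ = 1 = Σⱼ Qᵢⱼ². Then the nonnegative numbers Qᵢⱼ²(1 - Qᵢⱼ²) sum to
zero, and every entry is 0 or ±1. -/
theorem symmetryGroup_cubicMaterial {s : ℝ} (hs : s ≠ 0) (lam μ t : ℝ) :
    (cubicMaterial s lam μ t).symmetryGroup = fullOctahedralGroup := by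
  refine Set.Subset.antisymm (fun Q hQ => ?_) (fullOctahedralGroup_subset_symmetryGroup s lam μ t)
  suffices h : ∀ i j, Q.1 i j = 0 ∨ Q.1 i j ^ 2 = 1 by
    obtain ⟨σ, ε, h⟩ := exists_isSignedPerm_of_entries Q h
    exact h.mem_fullOctahedralGroup
  intro i
  have hrow : Q.1 i 0 ^ 2 + Q.1 i 1 ^ 2 + Q.1 i 2 ^ 2 = 1 := by
    have := congrFun (congrFun ((Matrix.mem_orthogonalGroup_iff _ _).1 Q.2) i) i
    simpa [Matrix.mul_apply, Fin.sum_univ_three, ← sq] using this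
  have hC := hQ.2 i i i i
  have hfour : Q.1 i 0 ^ 4 + Q.1 i 1 ^ 4 + Q.1 i 2 ^ 4 = 1 := by
    apply mul_left_cancel₀ hs
    simp [cubicMaterial, kron, kron₄, Fin.sum_univ_three] at hC
    linear_combination hC - (lam + 2 * μ) *
      (Q.1 i 0 ^ 2 + Q.1 i 1 ^ 2 + Q.1 i 2 ^ 2 + 1) * hrow
  have hle : ∀ j, Q.1 i j ^ 2 ≤ 1 := fun j => by
    rw [← hrow, ← Fin.sum_univ_three fun j => Q.1 i j ^ 2]
    exact Finset.single_le_sum (f := fun j => Q.1 i j ^ 2) (fun j _ => sq_nonneg _)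
      (Finset.mem_univ j)
  have hnn : ∀ j, 0 ≤ Q.1 i j ^ 2 * (1 - Q.1 i j ^ 2) := fun j =>
    mul_nonneg (sq_nonneg _) (by linarith [hle j])
  have hsum : ∑ j, Q.1 i j ^ 2 * (1 - Q.1 i j ^ 2) = 0 := by
    rw [Fin.sum_univ_three]
    linear_combination hrow - hfour
  intro j
  have := (Finset.sum_eq_zero_iff_of_nonneg fun j _ => hnn j).1 hsum j (Finset.mem_univ j)
  rcases mul_eq_zero.1 this with h | h
  · exact Or.inl (pow_eq_zero_iff two_ne_zero |>.1 h)
  · exact Or.inr (by linarith)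

theorem cubicMaterial_C_contraction (s lam μ t : ℝ) (k : Fin 3) (H : Fin 3 → Fin 3 → Fin 3 → ℝ) :
    ∑ i, ∑ l, ∑ m, (cubicMaterial s lam μ t).C i k l m * H i m l =
      s * H k k k + lam * ∑ l, H k l l + μ * (∑ i, H i k i + ∑ i, H i i k) := by
  fin_cases k <;> simp [cubicMaterial, kron, kron₄, Fin.sum_univ_three] <;> ring

theorem cubicMaterial_A_contraction (s lam μ t : ℝ) (k : Fin 3)
    (T : Fin 3 → Fin 3 → Fin 3 → Fin 3 → Fin 3 → ℝ) :
    ∑ i, ∑ j, ∑ l, ∑ m, ∑ n, (cubicMaterial s lam μ t).A i j k l m n * T j i n m l =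
      t * ((∑ i, T k i i k k) + (∑ j, T j k j k k) + (∑ i, T i i i i k) + ∑ i, T i i i k i) := by
  have e1 : ∑ i, ∑ j, ∑ l, ∑ m, ∑ n, kron i n * kron₄ j k l m * T j i n m l =
      ∑ i, T k i i k k := by
    simp [kron, kron₄, ite_and, eq_comm]
  have e2 : ∑ i, ∑ j, ∑ l, ∑ m, ∑ n, kron j n * kron₄ i k l m * T j i n m l =
      ∑ j, T j k j k k := by
    simp [kron, kron₄, ite_and, eq_comm]
  have e3 : ∑ i, ∑ j, ∑ l, ∑ m, ∑ n, kron k l * kron₄ i j m n * T j i n m l =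
      ∑ i, T i i i i k := by
    simp [kron, kron₄, ite_and]
  have e4 : ∑ i, ∑ j, ∑ l, ∑ m, ∑ n, kron k m * kron₄ i j l n * T j i n m l =
      ∑ i, T i i i k i := by
    simp [kron, kron₄, ite_and]
  rw [← e1, ← e2, ← e3, ← e4]
  simp only [← Finset.sum_add_distrib, Finset.mul_sum, cubicMaterial]
  refine Finset.sum_congr rfl fun i _ => Finset.sum_congr rfl fun j _ =>
    Finset.sum_congr rfl fun l _ => Finset.sum_congr rfl fun m _ => Finset.sum_congr rfl fun n _ => ?_
  ring

/-- Universality for the materials whose symmetry group is exactly the cubic group implies the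
differential equations. -/
theorem IsUniversal.cubicUniversalityPDEs {Ω : Set (Fin 3 → ℝ)} {u : (Fin 3 → ℝ) → Fin 3 → ℝ}
    (h : IsUniversal {𝓜 | 𝓜.symmetryGroup = fullOctahedralGroup} Ω u) (hΩ : IsOpen Ω)
    (hu : ∀ k, CkOn 4 Ω fun y => u y k) : CubicUniversalityPDEs Ω u := by
  have key : ∀ s lam μ t : ℝ, s ≠ 0 → ∀ k, ∀ x ∈ Ω,
      s * 𝐃 k (𝐃 k fun y => u y k) x + lam * ∑ l, 𝐃 k (𝐃 l fun y => u y l) x +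
        μ * (∑ i, 𝐃 i (𝐃 k fun y => u y i) x + ∑ i, 𝐃 i (𝐃 i fun y => u y k) x) -
        t * (∑ i, 𝐃 k (𝐃 i (𝐃 i (𝐃 k fun y => u y k))) x +
          ∑ j, 𝐃 j (𝐃 k (𝐃 j (𝐃 k fun y => u y k))) x +
          ∑ i, 𝐃 i (𝐃 i (𝐃 i (𝐃 i fun y => u y k))) x +
          ∑ i, 𝐃 i (𝐃 i (𝐃 i (𝐃 k fun y => u y i))) x) = 0 := by
    intro s lam μ t hs k x hx
    have h1 := h (cubicMaterial s lam μ t) (symmetryGroup_cubicMaterial hs lam μ t)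
    rw [Material.inEquilibrium_iff _ (fun _ _ _ _ _ => rfl) hΩ hu] at h1
    have h2 := h1 x hx k
    rwa [cubicMaterial_C_contraction s lam μ t k fun i m l => 𝐃 i (𝐃 m fun y => u y l) x,
      cubicMaterial_A_contraction s lam μ t k
        fun j i n m l => 𝐃 j (𝐃 i (𝐃 n (𝐃 m fun y => u y l))) x] at h2
  -- The class requires s ≠ 0, so s = 1 alone comes first; each other parameter is then switched on
  -- in turn and the known s-term removed.
  have hpure : ∀ k, ∀ x ∈ Ω, 𝐃 k (𝐃 k fun y => u y k) x = 0 := fun k x hx => by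
    linarith [key 1 0 0 0 one_ne_zero k x hx]
  have hdiv : ∀ k, ∀ x ∈ Ω, ∑ l, 𝐃 k (𝐃 l fun y => u y l) x = 0 := fun k x hx => by
    linarith [key 1 1 0 0 one_ne_zero k x hx, hpure k x hx]
  refine ⟨hpure, fun k x hx => ?_, hdiv, fun k x hx => ?_⟩
  · have h1 : ∑ i, 𝐃 i (𝐃 k fun y => u y i) x = 0 := by
      rw [← hdiv k x hx]
      exact Finset.sum_congr rfl fun i _ => partialDeriv_comm (n := 2) hΩ (hu i) i k x hx
    linarith [key 1 0 1 0 one_ne_zero k x hx, hpure k x hx]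
  · have hz : ∀ i j k, 𝐃 i (𝐃 j (𝐃 k (𝐃 k fun y => u y k))) x = 0 := fun i j k =>
      partialDeriv_eq_zero hΩ (partialDeriv_eq_zero hΩ (hpure k) j) i x hx
    have h12 := fun k => partialDeriv_comm₂ (n := 0) hΩ (hu k)
    have h23 := fun k => partialDeriv_comm₃ (n := 0) hΩ (hu k)
    have h34 := fun k => partialDeriv_comm₄ (n := 0) hΩ (hu k)
    have s1 : ∑ i, 𝐃 k (𝐃 i (𝐃 i (𝐃 k fun y => u y k))) x = 0 :=
      Finset.sum_eq_zero fun i _ => by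
        rw [h12 _ _ _ _ _ x hx, h23 _ _ _ _ _ x hx, hz]
    have s2 : ∑ j, 𝐃 j (𝐃 k (𝐃 j (𝐃 k fun y => u y k))) x = 0 :=
      Finset.sum_eq_zero fun j _ => by rw [h23 _ _ _ _ _ x hx, hz]
    have s4 : ∑ i, 𝐃 i (𝐃 i (𝐃 i (𝐃 k fun y => u y i))) x = 0 :=
      Finset.sum_eq_zero fun i _ => by
        rw [h34 _ _ _ _ _ x hx, h23 _ _ _ _ _ x hx, hz]
    linarith [key 1 0 0 1 one_ne_zero k x hx, hpure k x hx]

end StrainGradient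

/-! ### The equivalence of the four conditions -/

theorem mainTheorem12 (Ω : Set (Fin 3 → ℝ)) (hΩ : IsOpen Ω) (hconn : IsPreconnected Ω)
    (u : (Fin 3 → ℝ) → Fin 3 → ℝ) (hu : ContDiffOn ℝ 4 u Ω) :
    List.TFAE [
      -- universal for the materials whose symmetry group is exactly the cubic group
      StrainGradient.IsUniversal
        {𝓜 | 𝓜.symmetryGroup = StrainGradient.fullOctahedralGroup} Ω u,
      -- universal for all materials whose tensors are invariant under the cubic group
      StrainGradient.IsUniversal
        {𝓜 | StrainGradient.fullOctahedralGroup ⊆ 𝓜.symmetryGroup} Ω u,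
      ∃ (a a₁ b₁ c₁ d₁ d₂ d₃ : ℝ) (g₁ g₂ g₃ : ℝ → ℝ → ℝ),
        StrainGradient.HasCubicForm Ω u a a₁ b₁ c₁ d₁ d₂ d₃ g₁ g₂ g₃ ∧
        StrainGradient.IsHarmonic g₁ ∧ StrainGradient.IsHarmonic g₂ ∧
        StrainGradient.IsHarmonic g₃ ∧
        StrainGradient.FourthOrderPDEs g₁ ∧ StrainGradient.FourthOrderPDEs g₂ ∧
        StrainGradient.FourthOrderPDEs g₃,
      ∃ (a a₁ b₁ c₁ d₁ d₂ d₃ : ℝ) (g₁ g₂ g₃ : ℝ → ℝ → ℝ),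
        StrainGradient.HasCubicForm Ω u a a₁ b₁ c₁ d₁ d₂ d₃ g₁ g₂ g₃ ∧
        StrainGradient.IsHarmonic g₁ ∧ StrainGradient.IsHarmonic g₂ ∧
        StrainGradient.IsHarmonic g₃ ∧
        StrainGradient.FourthOrderRepresentation g₁ ∧
        StrainGradient.FourthOrderRepresentation g₂ ∧
        StrainGradient.FourthOrderRepresentation g₃] := by
  have hu' : ∀ k, StrainGradient.CkOn 4 Ω fun y => u y k := fun k => contDiffOn_pi.1 hu k
  tfae_have 2 → 1 := fun h 𝓜 h𝓜 => h 𝓜 (Eq.superset h𝓜)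
  tfae_have 1 → 3 := fun h => (h.cubicUniversalityPDEs hΩ hu').exists_cubicForm hΩ hconn hu'
  tfae_have 3 → 2 := by
    rintro ⟨a, a₁, b₁, c₁, d₁, d₂, d₃, g₁, g₂, g₃, h, h₁, h₂, h₃, p₁, p₂, p₃⟩
    exact (h.cubicUniversalityPDEs hΩ h₁ h₂ h₃ p₁ p₂ p₃).isUniversal hΩ hu'
  tfae_have 3 → 4 := by
    rintro ⟨a, a₁, b₁, c₁, d₁, d₂, d₃, g₁, g₂, g₃, h, h₁, h₂, h₃, p₁, p₂, p₃⟩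
    exact ⟨a, a₁, b₁, c₁, d₁, d₂, d₃, g₁, g₂, g₃, h, h₁, h₂, h₃,
      h₁.fourthOrderRepresentation p₁, h₂.fourthOrderRepresentation p₂,
      h₃.fourthOrderRepresentation p₃⟩
  tfae_have 4 → 3 := by
    rintro ⟨a, a₁, b₁, c₁, d₁, d₂, d₃, g₁, g₂, g₃, h, h₁, h₂, h₃, r₁, r₂, r₃⟩
    exact ⟨a, a₁, b₁, c₁, d₁, d₂, d₃, g₁, g₂, g₃, h, h₁, h₂, h₃,
      r₁.fourthOrderPDEs, r₂.fourthOrderPDEs, r₃.fourthOrderPDEs⟩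
  tfae_finish
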